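/- Consider a generalized switch with $n$ queues in discrete time. There is a finite set $\mathcal M$ of channel states with probability mass function $\psi$, and for each $m\in\mathcal M$ a nonempty finite set $\mathcal S^{(m)}\subset\mathbb R^n_+$ of feasible service rate vectors such that $x\in\mathcal S^{(m)}$ implies $x-x_i e^{(i)}\in\mathcal S^{(m)}$ for all $i$. In each time slot $k$ the channel state $M(k)$ (i.i.d. with law $\psi$) is observed; then the MaxWeight algorithm selects a schedule $s(k)\in\arg\max_{x\in\mathcal S^{(M(k))}}\langle q(k),x\rangle$, ties being broken at random; then arrivals $a(k)$ occur (i.i.d. random vectors, independent of the channel states and, given the queue lengths and channel state, of the schedule), and the queue lengths become $q(k+1)=q(k)+a(k)-s(k)+u(k)$, where $u_i(k)=s_i(k)-\min\{s_i(k),q_i(k)+a_i(k)\}$ is the unused service. Let $\mathcal C=\sum_{m}\psi_m\,\mathrm{ConvexHull}(\mathcal S^{(m)})$ be the capacity region, described by the minimum number $L$ of half-spaces as $\mathcal C=\{x\in\mathbb R^n_+:\langle c^{(\ell)},x\rangle\le b^{(\ell)},\ \ell=1,\dots,L\}$ with $c^{(\ell)}\ge 0$, $\|c^{(\ell)}\|=1$,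 $b^{(\ell)}>0$, and let $\mathcal F^{(\ell)}=\{x\in\mathcal C:\langle c^{(\ell)},x\rangle=b^{(\ell)}\}$. Let $b^{(m,\ell)}=\max_{x\in\mathcal S^{(m)}}\langle c^{(\ell)},x\rangle$, and let $\Sigma_B$ be the covariance matrix of the random variables $B_\ell=b^{(M,\ell)}$, where $M$ has law $\psi$. Fix $\nu$ in the boundary of $\mathcal C$. Let $P=\{\ell:\nu\in\mathcal F^{(\ell)}\}$, let $\mathcal K$ be the cone generated by $\{c^{(\ell)}:\ell\in P\}$, let $\tilde P\subset P$ be such that $\{c^{(\ell)}:\ell\in\tilde P\}$ is linearly independent and spans the subspace generated by $\{c^{(\ell)}:\ell\in P\}$, and let $C$ be the matrix with columns $c^{(\ell)}$, $\ell\in\tilde P$. For each $\epsilon\in(0,1)$ consider the above switch, operating under MaxWeight, with arrival vectors $a^{(\epsilon)}(k)$ satisfying $0\le a^{(\epsilon)}_i(k)\le A_{\max}$ almost surely for a constant $A_{\max}$ that does not depend on $\epsilon$, with mean $(1-\epsilon)\nu$ and covariance matrix $\Sigma_a^{(\epsilon)}$, and let $\overline q^{(\epsilon)}$ be a random vector whose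 law is a stationary law of the Markov chain of queue lengths. Suppose that $\lim_{\epsilon\downarrow0}\Sigma_a^{(\epsilon)}=\Sigma_a$ component-wise, and let $\sigma_a$ be the vector with elements $\sigma_{a_i}=\sqrt{(\Sigma_a)_{i,i}}$. If the cone $\mathcal K$ is $n$-dimensional, then for every $w\in\bigcap_{\ell\in P}\mathcal F^{(\ell)}$ the expectation $\mathbb E\langle\overline q^{(\epsilon)},w\rangle$ is finite for each $\epsilon\in(0,1)$, and $$\lim_{\epsilon\downarrow0}\epsilon\,\mathbb E\langle\overline q^{(\epsilon)},w\rangle=\tfrac12\Big(\|\sigma_a\|^2+\mathbf 1^T\big((C^TC)^{-1}\circ\Sigma_B\big)\mathbf 1\Big),$$ where $\circ$ is the entrywise product and $\Sigma_B$ is restricted to the indices in $\tilde P$. In particular the limit depends on $\Sigma_a$ only through its diagonal, that is, not on the correlation among the arrivals to different queues. -/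

import Mathlib

open MeasureTheory ProbabilityTheory Filter Topology
open scoped RealInnerProductSpace Matrix

noncomputable section

/-- Vectors in `ℝⁿ`, with the Euclidean norm and the dot product. -/
abbrev Vec (n : ℕ) := EuclideanSpace ℝ (Fin n)

/-- The data of a generalized switch with `n` queues that do not depend on the arrivals: finitely
many channel states `m : M` with probability mass function `ψ`, and for every channel state a finite
set `S m` of feasible service rate vectors, which is closed under replacing a coordinate by `0`. -/
structure GeneralizedSwitch (n : ℕ) (M : Type*) [Fintype M] where
  ψ : M → ℝ
  ψ_mem : ψ ∈ stdSimplex ℝ M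
  S : M → Finset (Vec n)
  S_nonempty : ∀ m, (S m).Nonempty
  S_nonneg : ∀ m, ∀ x ∈ S m, ∀ i, 0 ≤ x i
  S_proj : ∀ m, ∀ x ∈ S m, ∀ i, x - EuclideanSpace.single i (x i) ∈ S m

namespace GeneralizedSwitch

variable {n : ℕ} {M : Type*} [Fintype M]

/-- The capacity region `∑ₘ ψₘ ConvexHull (S m)`. -/
def capacityRegion (G : GeneralizedSwitch n M) : Set (Vec n) :=
  {x | ∃ y : M → Vec n, (∀ m, y m ∈ convexHull ℝ (G.S m : Set (Vec n))) ∧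
    x = ∑ m, G.ψ m • y m}

/-- The maximum `c`-weighted service rate `max_{x ∈ S m} ⟨c, x⟩` available in channel state `m`. -/
def maxRate (G : GeneralizedSwitch n M) (c : Vec n) (m : M) : ℝ :=
  (G.S m).sup' (G.S_nonempty m) fun x => ⟪c, x⟫

/-- Expectation of a function of the channel state. -/
def channelMean (G : GeneralizedSwitch n M) (f : M → ℝ) : ℝ := ∑ m, G.ψ m * f m

/-- The MaxWeight scheduling algorithm: when the queue lengths are `q` and the channel state is `m`,
the schedule is drawn from the set of maximizers of `⟨q, ·⟩` over `S m`, ties being broken at random: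
`prob q m x` is the probability that schedule `x` is selected. -/
structure MaxWeight (G : GeneralizedSwitch n M) where
  prob : Vec n → M → Vec n → ℝ
  measurable_prob : ∀ m x, Measurable fun q => prob q m x
  prob_nonneg : ∀ q m x, 0 ≤ prob q m x
  sum_prob : ∀ q m, ∑ x ∈ G.S m, prob q m x = 1
  argmax : ∀ q m, ∀ x ∈ G.S m, prob q m x ≠ 0 → ∀ y ∈ G.S m, ⟪q, y⟫ ≤ ⟪q, x⟫

end GeneralizedSwitch

/-- Unused service: the potential service `s` minus the number of jobs actually processed, when the
queue lengths are `q` and the arrivals are `a`. -/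
def unusedService {n : ℕ} (q a s : Vec n) : Vec n :=
  WithLp.toLp 2 fun i => s i - min (s i) (q i + a i)

/-- The queue lengths one time slot later. -/
def nextQueue {n : ℕ} (q a s : Vec n) : Vec n := q + a - s + unusedService q a s

theorem measurable_nextQueue {n : ℕ} (s : Vec n) :
    Measurable fun p : Vec n × Vec n => nextQueue p.1 p.2 s := by
  have h : Measurable fun p : Vec n × Vec n => unusedService p.1 p.2 s := by
    unfold unusedService
    refine (WithLp.measurable_toLp 2 (Fin n → ℝ)).comp ?_
    refine measurable_pi_lambda _ fun i => ?_
    fun_prop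
  unfold nextQueue
  exact ((measurable_fst.add measurable_snd).sub measurable_const).add h

theorem measurable_nextQueue_right {n : ℕ} (q s : Vec n) :
    Measurable fun a : Vec n => nextQueue q a s := by
  have h : Measurable fun a : Vec n => unusedService q a s := by
    unfold unusedService
    refine (WithLp.measurable_toLp 2 (Fin n → ℝ)).comp ?_
    refine measurable_pi_lambda _ fun i => ?_
    fun_prop
  unfold nextQueue
  exact ((measurable_const.add measurable_id).sub measurable_const).add h

namespace GeneralizedSwitch

variable {n : ℕ} {M : Type*} [Fintype M]

/-- The one-step law from queue lengths `q`: the channel state has law `ψ` and is independent of the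
arrivals, which have law `α`; the schedule is chosen by MaxWeight before the arrivals occur. -/
def stepLaw (G : GeneralizedSwitch n M) (R : G.MaxWeight) (α : ProbabilityMeasure (Vec n))
    (q : Vec n) : Measure (Vec n) :=
  ∑ m, ∑ x ∈ G.S m, ENNReal.ofReal (G.ψ m * R.prob q m x) •
    (α : Measure (Vec n)).map fun a => nextQueue q a x

theorem measurable_stepLaw (G : GeneralizedSwitch n M) (R : G.MaxWeight)
    (α : ProbabilityMeasure (Vec n)) : Measurable (G.stepLaw R α) := by
  refine Measure.measurable_of_measurable_coe _ fun A hA => ?_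
  simp only [stepLaw, Measure.coe_finsetSum, Finset.sum_apply, Measure.smul_apply, smul_eq_mul]
  refine Finset.measurable_sum _ fun m _ => Finset.measurable_sum _ fun x _ => ?_
  refine ((R.measurable_prob m x).const_mul _).ennreal_ofReal.mul ?_
  have h : ∀ q : Vec n, (α : Measure (Vec n)).map (fun a => nextQueue q a x) A =
      (α : Measure (Vec n)) (Prod.mk q ⁻¹' ((fun p : Vec n × Vec n => nextQueue p.1 p.2 x) ⁻¹' A)) :=
    fun q => Measure.map_apply (measurable_nextQueue_right q x) hA
  simp only [h]
  exact measurable_measure_prodMk_left (measurable_nextQueue x hA)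

/-- The transition kernel of the Markov chain of queue lengths of the generalized switch operating
under MaxWeight, with i.i.d. arrival vectors of law `α`. -/
def queueKernel (G : GeneralizedSwitch n M) (R : G.MaxWeight) (α : ProbabilityMeasure (Vec n)) :
    Kernel (Vec n) (Vec n) where
  toFun := G.stepLaw R α
  measurable' := G.measurable_stepLaw R α

instance (G : GeneralizedSwitch n M) (R : G.MaxWeight) (α : ProbabilityMeasure (Vec n)) :
    IsMarkovKernel (G.queueKernel R α) := by
  refine ⟨fun q => ⟨?_⟩⟩
  change G.stepLaw R α q Set.univ = 1
  have h : ∀ x : Vec n, (α : Measure (Vec n)).map (fun a => nextQueue q a x) Set.univ = 1 := by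
    intro x
    rw [Measure.map_apply (measurable_nextQueue_right q x) MeasurableSet.univ, Set.preimage_univ,
      measure_univ]
  simp only [stepLaw, Measure.coe_finsetSum, Finset.sum_apply, Measure.smul_apply, smul_eq_mul,
    h, mul_one]
  have h2 : ∀ m, ∑ x ∈ G.S m, ENNReal.ofReal (G.ψ m * R.prob q m x) = ENNReal.ofReal (G.ψ m) := by
    intro m
    rw [← ENNReal.ofReal_sum_of_nonneg
      (fun x _ => mul_nonneg (G.ψ_mem.1 m) (R.prob_nonneg q m x)), ← Finset.mul_sum,
      R.sum_prob, mul_one]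
  simp only [h2]
  rw [← ENNReal.ofReal_sum_of_nonneg (fun m _ => G.ψ_mem.1 m), G.ψ_mem.2, ENNReal.ofReal_one]

/-- `π` is a steady-state (stationary) law of the Markov chain of queue lengths. -/
def IsSteadyState (G : GeneralizedSwitch n M) (R : G.MaxWeight) (α π : ProbabilityMeasure (Vec n)) :
    Prop :=
  Kernel.Invariant (G.queueKernel R α) (π : Measure (Vec n))

end GeneralizedSwitch

/-- `C` is the set of vectors in the nonnegative orthant that lie in the `L` half-spaces
`⟨c ℓ, x⟩ ≤ b ℓ`. -/
def IsCutOutBy {n : ℕ} (C : Set (Vec n)) {L : ℕ} (c : Fin L → Vec n) (b : Fin L → ℝ) : Prop :=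
  C = {x | (∀ i, 0 ≤ x i) ∧ ∀ ℓ, ⟪c ℓ, x⟫ ≤ b ℓ}

/-- A description of `C` by the minimum number `L` of half-spaces, with normalized normal vectors. -/
structure FacetDescription {n : ℕ} (C : Set (Vec n)) (L : ℕ) where
  c : Fin L → Vec n
  b : Fin L → ℝ
  cutOut : IsCutOutBy C c b
  minimal : ∀ (L' : ℕ) (c' : Fin L' → Vec n) (b' : Fin L' → ℝ), IsCutOutBy C c' b' → L ≤ L'
  c_nonneg : ∀ ℓ i, 0 ≤ c ℓ i
  b_pos : ∀ ℓ, 0 < b ℓ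
  norm_c : ∀ ℓ, ‖c ℓ‖ = 1

namespace FacetDescription

variable {n L : ℕ} {C : Set (Vec n)}

/-- The `ℓ`-th facet. -/
def facet (D : FacetDescription C L) (ℓ : Fin L) : Set (Vec n) := {x ∈ C | ⟪D.c ℓ, x⟫ = D.b ℓ}

open Classical in
/-- The set `P` of (indices of) all the facets that contain `ν`. -/
def active (D : FacetDescription C L) (ν : Vec n) : Finset (Fin L) :=
  Finset.univ.filter fun ℓ => ν ∈ D.facet ℓ

/-- The cone `K` generated by the normal vectors of the facets that contain `ν`. -/
def cone (D : FacetDescription C L) (ν : Vec n) : Set (Vec n) :=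
  {x | (∀ i, 0 ≤ x i) ∧ ∃ ξ : Fin L → ℝ, (∀ ℓ ∈ D.active ν, 0 ≤ ξ ℓ) ∧
    x = ∑ ℓ ∈ D.active ν, ξ ℓ • D.c ℓ}

/-- `Pt ⊆ P` indexes a linearly independent family of normal vectors that spans the subspace
generated by all the normal vectors with index in `P`. -/
def IsBasisIndex (D : FacetDescription C L) (ν : Vec n) (Pt : Finset (Fin L)) : Prop :=
  Pt ⊆ D.active ν ∧ LinearIndependent ℝ (fun ℓ : Pt => D.c ℓ) ∧
    Submodule.span ℝ (D.c '' (Pt : Set (Fin L))) =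
      Submodule.span ℝ (D.c '' (D.active ν : Set (Fin L)))

/-- The matrix whose columns are the normal vectors with index in `Pt`. -/
def colMatrix (D : FacetDescription C L) (Pt : Finset (Fin L)) : Matrix (Fin n) Pt ℝ :=
  Matrix.of fun i ℓ => D.c ℓ i

end FacetDescription

/-- The covariance matrix of the random variables `B_ℓ = max_{x ∈ S m} ⟨c ℓ, x⟩`, where `m` is the
random channel state. -/
def GeneralizedSwitch.covB {n L : ℕ} {M : Type*} [Fintype M] (G : GeneralizedSwitch n M)
    (D : FacetDescription G.capacityRegion L) : Matrix (Fin L) (Fin L) ℝ :=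
  Matrix.of fun ℓ₁ ℓ₂ =>
    G.channelMean (fun m => G.maxRate (D.c ℓ₁) m * G.maxRate (D.c ℓ₂) m) -
      G.channelMean (G.maxRate (D.c ℓ₁)) * G.channelMean (G.maxRate (D.c ℓ₂))

/-- The arrival vector is nonnegative and bounded by `Amax`, with probability one. -/
def BoundedArrivals {n : ℕ} (α : ProbabilityMeasure (Vec n)) (Amax : ℝ) : Prop :=
  ∀ᵐ a ∂(α : Measure (Vec n)), ∀ i, 0 ≤ a i ∧ a i ≤ Amax

/-- The covariance matrix of the arrival vector. -/
def arrivalCov {n : ℕ} (α : ProbabilityMeasure (Vec n)) : Matrix (Fin n) (Fin n) ℝ :=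
  Matrix.of fun i j => cov[fun a : Vec n => a i, fun a : Vec n => a j; (α : Measure (Vec n))]

end

/-! Since `K` is full-dimensional, the active normals span the space. Hence `ν` is the only point on
all active facets (so `w = ν`). In each channel state of positive probability the sum `c` of these
normals has a unique maximizing schedule `V m`, and `ν` is the mean of `V` (`exists_exposedVertex`).

Two test functions are put into stationarity. The squared norm gives `2 (ε E⟪q,ν⟫ + E slack) = E
secondOrder` (`integral_secondOrder`); no cross term with the unused service survives. The linear
function `⟪c, ·⟫` gives `E loss = ε ⟪c,ν⟫` (`integral_loss`), so wrong schedules and unused service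
are rare. The loss controls the second order term, which therefore tends to the trace of `Σ_a` plus
`E‖V - ν‖²` (`abs_secondOrder_sub_le`).

It remains to show `E slack → 0`. The slack is at most a constant times the distance to the collapse
cone, and it is positive only where the loss is at least some fixed `η`. A Hoffman bound makes the
slack at least `δ` times the distance, so the fourth power of the distance is a Lyapunov function
and the second moment of the distance stays bounded as `ε → 0` (`exists_second_moment_bound`).
Weighting the two facts by `√ε` and `1/√ε` gives `E slack = O(√ε)`.

Finally `⟪c ℓ, V - ν⟫ = B_ℓ - E B_ℓ` for active `ℓ`, so the inverse Gram matrix turns `E‖V - ν‖²`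
into the Hadamard expression in `Σ_B` (`sum_inv_colMatrix_hadamard_covB`). -/

/-! ### Drift conditions and invariant laws of Markov kernels. -/

section Markov

variable {E : Type*} [MeasurableSpace E] {κ : Kernel E E} [IsMarkovKernel κ] {π : Measure E}
  [IsProbabilityMeasure π]

theorem integrable_of_bounded_of_measurable {Ω : Type*} [MeasurableSpace Ω] {μ : Measure Ω}
    [IsFiniteMeasure μ] {f : Ω → ℝ} (hf : Measurable f) {B : ℝ} (hB : ∀ x, |f x| ≤ B) :
    Integrable f μ :=
  Integrable.of_bound hf.aestronglyMeasurable B (ae_of_all _ hB)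

omit [IsMarkovKernel κ] in
theorem measurable_integral_kernel {f : E → ℝ} (hf : Measurable f) :
    Measurable fun q => ∫ y, f y ∂κ q :=
  (hf.stronglyMeasurable.integral_kernel).measurable

/-- A bounded observable has mean zero drift under an invariant law. -/
theorem integral_kernel_of_invariant (h : Kernel.Invariant κ π) {f : E → ℝ} (hf : Measurable f)
    {B : ℝ} (hB : ∀ x, |f x| ≤ B) : ∫ q, ∫ y, f y ∂κ q ∂π = ∫ q, f q ∂π := by
  have h1 : Integrable f (π.bind κ) := integrable_of_bounded_of_measurable hf hB
  have h2 : π.bind κ = π := h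
  rw [Measure.comp_eq_comp_const_apply] at h1 h2
  have h3 := Kernel.integral_comp h1
  rw [h2] at h3
  simpa using h3.symm

/-- Foster–Lyapunov comparison: a nonnegative Lyapunov function whose drift is at most `b - g`
bounds the stationary mean of `g` by `b`. -/
theorem integrable_and_integral_le_of_drift (h : Kernel.Invariant κ π) {f g : E → ℝ} {b : ℝ}
    (hb : 0 ≤ b) (hf : Measurable f) (hf0 : ∀ q, 0 ≤ f q) (hg : Measurable g)
    (hg0 : ∀ᵐ q ∂π, 0 ≤ g q) (hint : ∀ᵐ q ∂π, Integrable f (κ q))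
    (hd : ∀ᵐ q ∂π, ∫ y, f y ∂κ q ≤ f q - g q + b) :
    Integrable g π ∧ ∫ q, g q ∂π ≤ b := by
  have key : ∀ N : ℕ, ∫⁻ q, ENNReal.ofReal ({q | f q ≤ N}.indicator g q) ∂π ≤ ENNReal.ofReal b := by
    intro N
    -- `f` need not be integrable under `π`, so it is truncated. Where `f ≤ N`, truncation can only
    -- lower the mean after one step, so the drift bound survives; where `f > N`, the truncated
    -- drift is nonpositive and `g` is replaced by `0`.
    set fN : E → ℝ := fun q => min (f q) N with hfN
    have mN : Measurable fN := hf.min measurable_const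
    have bN : ∀ q, |fN q| ≤ N := fun q => by
      rw [abs_of_nonneg (le_min (hf0 q) N.cast_nonneg)]; exact min_le_right _ _
    have bK : ∀ q, |∫ y, fN y ∂κ q| ≤ N := fun q => by
      have := norm_integral_le_of_norm_le_const (μ := κ q) (f := fN) (C := N)
        (ae_of_all _ fun y => (Real.norm_eq_abs _).trans_le (bN y))
      simpa using this
    have iK : Integrable (fun q => ∫ y, fN y ∂κ q) π :=
      integrable_of_bounded_of_measurable (measurable_integral_kernel mN) bK
    have iN : Integrable fN π := integrable_of_bounded_of_measurable mN bN
    have e0 := integral_kernel_of_invariant h mN bN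
    have mI : Measurable ({q | f q ≤ N}.indicator g) :=
      hg.indicator (measurableSet_le hf measurable_const)
    have le : ∀ᵐ q ∂π, {q | f q ≤ N}.indicator g q ≤ fN q - ∫ y, fN y ∂κ q + b := by
      filter_upwards [hint, hd] with q h1 h2
      have l1 : ∫ y, fN y ∂κ q ≤ ∫ y, f y ∂κ q :=
        integral_mono (integrable_of_bounded_of_measurable mN bN) h1 fun y => min_le_left _ _
      have l2 := (abs_le.1 (bK q)).2
      by_cases hq : f q ≤ N
      · rw [Set.indicator_of_mem (show q ∈ {q | f q ≤ N} from hq)]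
        have : fN q = f q := min_eq_left hq
        linarith
      · rw [Set.indicator_of_notMem (show q ∉ {q | f q ≤ N} from hq)]
        have : fN q = N := min_eq_right (not_le.1 hq).le
        linarith
    have nn : ∀ᵐ q ∂π, 0 ≤ {q | f q ≤ N}.indicator g q := by
      filter_upwards [hg0] with q h1
      exact Set.indicator_apply_nonneg fun _ => h1
    have iR : Integrable (fun q => fN q - ∫ y, fN y ∂κ q + b) π :=
      (iN.sub iK).add (integrable_const b)
    have iI : Integrable ({q | f q ≤ N}.indicator g) π := by
      refine iR.mono' mI.aestronglyMeasurable ?_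
      filter_upwards [le, nn] with q h1 h2
      rwa [Real.norm_of_nonneg h2]
    rw [← ofReal_integral_eq_lintegral_ofReal iI nn]
    refine ENNReal.ofReal_le_ofReal ?_
    calc ∫ q, {q | f q ≤ N}.indicator g q ∂π ≤ ∫ q, (fN q - ∫ y, fN y ∂κ q + b) ∂π :=
          integral_mono_ae iI iR le
      _ = b := by
          rw [integral_add (f := fun q => fN q - ∫ y, fN y ∂κ q) (iN.sub iK) (integrable_const b),
            integral_sub iN iK, e0]
          simp
  -- Fatou's lemma removes the truncation.
  have lim : ∫⁻ q, ENNReal.ofReal (g q) ∂π ≤ ENNReal.ofReal b := by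
    have t : ∀ q, Tendsto (fun N : ℕ => ENNReal.ofReal ({q | f q ≤ N}.indicator g q)) atTop
        (𝓝 (ENNReal.ofReal (g q))) := by
      intro q
      refine tendsto_const_nhds.congr' ?_
      filter_upwards [eventually_ge_atTop ⌈f q⌉₊] with N hN
      rw [Set.indicator_of_mem]
      exact (Nat.le_ceil (f q)).trans (by exact_mod_cast hN)
    have := lintegral_liminf_le (μ := π) (u := (atTop : Filter ℕ))
      (f := fun (N : ℕ) q => ENNReal.ofReal ({q | f q ≤ N}.indicator g q))
      (fun N => (hg.indicator (measurableSet_le hf measurable_const)).ennreal_ofReal)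
    simp only [(t _).liminf_eq] at this
    refine this.trans ?_
    refine (liminf_le_liminf (Eventually.of_forall key)).trans ?_
    simp
  have ig : Integrable g π := by
    refine ⟨hg.aestronglyMeasurable, ?_⟩
    rw [hasFiniteIntegral_iff_ofReal hg0]
    exact lim.trans_lt ENNReal.ofReal_lt_top
  refine ⟨ig, ?_⟩
  rw [← ofReal_integral_eq_lintegral_ofReal ig hg0] at lim
  exact (ENNReal.ofReal_le_ofReal_iff hb).1 lim

/-- Clipping is 1-Lipschitz, so the increments of a clipped observable are dominated by those of the
observable itself, uniformly in `N`. -/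
theorem abs_clip_sub_clip_le (x y N : ℝ) :
    |max (-N) (min x N) - max (-N) (min y N)| ≤ |x - y| :=
  (abs_max_sub_max_le_max _ _ _ _).trans <| by
    simp only [sub_self, abs_zero]
    refine max_le (abs_nonneg _) ((abs_min_sub_min_le_max _ _ _ _).trans ?_)
    simp

/-- An observable with integrable increments has mean zero drift under an invariant law. -/
theorem integral_drift_eq_zero (h : Kernel.Invariant κ π) {f D : E → ℝ} (hf : Measurable f)
    (hD : Integrable D π) (hint : ∀ᵐ q ∂π, Integrable (fun y => f y - f q) (κ q))
    (hle : ∀ᵐ q ∂π, ∫ y, |f y - f q| ∂κ q ≤ D q) :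
    ∫ q, ∫ y, (f y - f q) ∂κ q ∂π = 0 := by
  set F : ℕ → E → ℝ := fun N q => max (-(N : ℝ)) (min (f q) N) with hF
  have mF : ∀ N, Measurable (F N) := fun N => measurable_const.max (hf.min measurable_const)
  have bF : ∀ N q, |F N q| ≤ N := fun N q => by
    have : (0 : ℝ) ≤ N := N.cast_nonneg
    refine abs_le.2 ⟨le_max_left _ _, max_le (by linarith) (min_le_right _ _)⟩
  have tF : ∀ q, Tendsto (fun N => F N q) atTop (𝓝 (f q)) := by
    intro q
    refine tendsto_const_nhds.congr' ?_
    filter_upwards [eventually_ge_atTop ⌈|f q|⌉₊] with N hN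
    have h1 : |f q| ≤ N := (Nat.le_ceil _).trans (by exact_mod_cast hN)
    have h2 := abs_le.1 h1
    simp only [hF]
    rw [min_eq_left h2.2, max_eq_right h2.1]
  have iF : ∀ N (μ : Measure E) [IsProbabilityMeasure μ], Integrable (F N) μ := fun N μ _ =>
    integrable_of_bounded_of_measurable (mF N) (bF N)
  have eq : ∀ N q, ∫ y, (F N y - F N q) ∂κ q = ∫ y, F N y ∂κ q - F N q := fun N q => by
    rw [integral_sub (iF N _) (integrable_const _)]; simp
  have mI : ∀ N, Measurable fun q => ∫ y, (F N y - F N q) ∂κ q := fun N => by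
    simp only [eq]; exact (measurable_integral_kernel (mF N)).sub (mF N)
  have z : ∀ N, ∫ q, ∫ y, (F N y - F N q) ∂κ q ∂π = 0 := fun N => by
    simp only [eq]
    rw [integral_sub _ (iF N _), integral_kernel_of_invariant h (mF N) (bF N), sub_self]
    refine integrable_of_bounded_of_measurable (B := N) (measurable_integral_kernel (mF N)) ?_
    intro q
    have := norm_integral_le_of_norm_le_const (μ := κ q) (f := F N) (C := N)
      (ae_of_all _ fun y => (Real.norm_eq_abs _).trans_le (bF N y))
    simpa using this
  have t : Tendsto (fun N => ∫ q, ∫ y, (F N y - F N q) ∂κ q ∂π) atTop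
      (𝓝 (∫ q, ∫ y, (f y - f q) ∂κ q ∂π)) := by
    refine tendsto_integral_of_dominated_convergence D
      (fun N => (mI N).aestronglyMeasurable) hD ?_ ?_
    · intro N
      filter_upwards [hint, hle] with q h1 h2
      refine (norm_integral_le_integral_norm _).trans (le_trans ?_ h2)
      refine integral_mono ((iF N _).sub (integrable_const _)).norm h1.abs ?_
      intro y
      exact abs_clip_sub_clip_le _ _ _
    · filter_upwards [hint] with q h1
      refine tendsto_integral_of_dominated_convergence (fun y => |f y - f q|)
        (fun N => ((mF N).sub_const _).aestronglyMeasurable) h1.abs ?_ ?_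
      · intro N
        exact ae_of_all _ fun y => abs_clip_sub_clip_le _ _ _
      · exact ae_of_all _ fun y => (tF y).sub (tF q)
  simp only [z] at t
  exact (tendsto_nhds_unique t tendsto_const_nhds)

end Markov

/-! ### Hoffman's error bound for polyhedral cones. -/

section ErrorBound

variable {E : Type*} [NormedAddCommGroup E] [InnerProductSpace ℝ E]

/-- The polyhedral cone `{p | ⟪g j, p⟫ ≤ 0 for all j}`. -/
def polyhedralCone {ι : Type*} (g : ι → E) : Set E := {p | ∀ j, ⟪g j, p⟫ ≤ 0}

theorem isClosed_polyhedralCone {ι : Type*} (g : ι → E) : IsClosed (polyhedralCone g) := by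
  simp only [polyhedralCone, Set.ofPred_forall]
  exact isClosed_iInter fun j => isClosed_le (by fun_prop) continuous_const

theorem zero_mem_polyhedralCone {ι : Type*} (g : ι → E) : (0 : E) ∈ polyhedralCone g := by
  simp [polyhedralCone]

theorem convex_polyhedralCone {ι : Type*} (g : ι → E) : Convex ℝ (polyhedralCone g) := by
  intro x hx y hy a b ha hb _ j
  rw [inner_add_right, inner_smul_right, inner_smul_right]
  have := mul_nonpos_of_nonneg_of_nonpos ha (hx j)
  have := mul_nonpos_of_nonneg_of_nonpos hb (hy j)
  linarith

/-- A unit vector in the polar of `{y | ⟪g j, y⟫ ≤ 0 for all j ∈ J}` makes, uniformly, an acute angle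
with one of the generators `g j`, `j ∈ J`. -/
theorem exists_pos_le_inner_of_mem_polar [FiniteDimensional ℝ E] {ι : Type*} [Finite ι] (g : ι → E)
    (J : Set ι) :
    ∃ δ > 0, ∀ h : E, ‖h‖ = 1 → (∀ y, (∀ j ∈ J, ⟪g j, y⟫ ≤ 0) → ⟪h, y⟫ ≤ 0) →
      ∃ j ∈ J, δ ≤ ⟪g j, h⟫ := by
  classical
  cases nonempty_fintype ι
  set H : Set E := {h | ‖h‖ = 1} ∩ {h | ∀ y, (∀ j ∈ J, ⟪g j, y⟫ ≤ 0) → ⟪h, y⟫ ≤ 0} with hH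
  have cH : IsCompact H := by
    have h1 : {h : E | ‖h‖ = 1} = Metric.sphere 0 1 := by ext; simp
    rw [hH, h1]
    refine (isCompact_sphere 0 1).inter_right ?_
    simp only [Set.ofPred_forall]
    exact isClosed_iInter fun y => isClosed_iInter fun _ => isClosed_le (by fun_prop) continuous_const
  -- `F` is positive on the compact set `H`: if all `⟪g j, h⟫ ≤ 0`, then `y = h` is admissible in
  -- the polar condition and `‖h‖² ≤ 0`. The minimum of `F` is then shared among at most `card ι`
  -- terms; the `+ 1` below avoids division by zero.
  set F : E → ℝ := fun h => ∑ j ∈ Finset.univ.filter (· ∈ J), max ⟪g j, h⟫ 0 with hF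
  have cF : Continuous F := by fun_prop
  have pos : ∀ h ∈ H, 0 < F h := by
    rintro h ⟨h1, h2⟩
    obtain ⟨j, hj, hj'⟩ : ∃ j ∈ J, 0 < ⟪g j, h⟫ := by
      by_contra! hc
      have := h2 h hc
      rw [real_inner_self_eq_norm_sq, show ‖h‖ = 1 from h1] at this
      norm_num at this
    refine Finset.sum_pos' (fun _ _ => le_max_right _ _) ⟨j, by simpa using hj, lt_max_of_lt_left hj'⟩
  have : ∃ δ > 0, ∀ h ∈ H, δ ≤ F h := by
    rcases H.eq_empty_or_nonempty with he | hne
    · exact ⟨1, one_pos, by simp [he]⟩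
    · obtain ⟨h0, hh0, hmin⟩ := cH.exists_isMinOn hne cF.continuousOn
      exact ⟨F h0, pos _ hh0, fun h hh => hmin hh⟩
  obtain ⟨δ, hδ, hle⟩ := this
  refine ⟨δ / (Fintype.card ι + 1), by positivity, fun h h1 h2 => ?_⟩
  by_contra! hc
  have h3 := hle h ⟨h1, h2⟩
  have h4 : F h ≤ ∑ j ∈ Finset.univ.filter (· ∈ J), δ / (Fintype.card ι + 1) := by
    refine Finset.sum_le_sum fun j hj => max_le (hc j (by simpa using hj)).le (by positivity)
  rw [Finset.sum_const, nsmul_eq_mul] at h4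
  have h5 : ((Finset.univ.filter (· ∈ J)).card : ℝ) ≤ Fintype.card ι := by
    exact_mod_cast Finset.card_le_univ _
  have h6 : (Fintype.card ι : ℝ) * (δ / (Fintype.card ι + 1)) < δ := by
    rw [mul_div_assoc', div_lt_iff₀ (by positivity)]; nlinarith
  have h7 : ((Finset.univ.filter (· ∈ J)).card : ℝ) * (δ / (Fintype.card ι + 1)) ≤
    (Fintype.card ι : ℝ) * (δ / (Fintype.card ι + 1)) := by gcongr
  linarith

/-- Hoffman's error bound for a polyhedral cone. -/
theorem exists_polyhedralCone_error_bound [FiniteDimensional ℝ E] {ι : Type*} [Finite ι]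
    (g : ι → E) :
    ∃ δ > 0, ∀ q, ∃ p ∈ polyhedralCone g, Metric.infDist q (polyhedralCone g) = ‖q - p‖ ∧
      (q = p ∨ ∃ j, δ * ‖q - p‖ ≤ ⟪g j, q⟫) := by
  -- There are finitely many possible sets `J` of tight constraints, so one `δ` serves them all.
  have ev : ∀ J : Set ι, ∀ᶠ δ in 𝓝[>] (0 : ℝ), ∀ h : E, ‖h‖ = 1 →
      (∀ y, (∀ j ∈ J, ⟪g j, y⟫ ≤ 0) → ⟪h, y⟫ ≤ 0) → ∃ j ∈ J, δ ≤ ⟪g j, h⟫ := by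
    intro J
    obtain ⟨δ, hδ, hJ⟩ := exists_pos_le_inner_of_mem_polar g J
    filter_upwards [Ioo_mem_nhdsGT hδ] with δ' hδ' h h1 h2
    obtain ⟨j, hj, hj'⟩ := hJ h h1 h2
    exact ⟨j, hj, hδ'.2.le.trans hj'⟩
  obtain ⟨δ, hall, hδ⟩ := ((eventually_all.2 ev).and self_mem_nhdsWithin).exists
  refine ⟨δ, hδ, fun q => ?_⟩
  obtain ⟨p, hp, hpd⟩ := (isClosed_polyhedralCone g).exists_infDist_eq_dist
    ⟨0, zero_mem_polyhedralCone g⟩ q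
  refine ⟨p, hp, by rw [hpd, dist_eq_norm], ?_⟩
  by_cases hqp : q = p
  · exact Or.inl hqp
  right
  have var : ∀ y ∈ polyhedralCone g, ⟪q - p, y - p⟫ ≤ 0 := by
    refine (norm_eq_iInf_iff_real_inner_le_zero (convex_polyhedralCone g) hp).1 ?_
    rw [← dist_eq_norm, ← hpd, Metric.infDist_eq_iInf]
    simp [dist_eq_norm]
  have hn : 0 < ‖q - p‖ := norm_pos_iff.2 (sub_ne_zero.2 hqp)
  -- The projection residual is polar to the directions allowed by the constraints tight at `p`: a
  -- short move from `p` in such a direction stays in the cone. Tightness then replaces `⟪g j, q -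
  -- p⟫` by `⟪g j, q⟫`.
  obtain ⟨j, hj, hj'⟩ := hall {j | ⟪g j, p⟫ = 0} (‖q - p‖⁻¹ • (q - p))
    (by rw [norm_smul, norm_inv, norm_norm, inv_mul_cancel₀ hn.ne']) (by
      intro y hy
      have evt : ∀ᶠ t in 𝓝[>] (0 : ℝ), p + t • y ∈ polyhedralCone g := by
        refine eventually_all.2 fun j => ?_
        by_cases hj : ⟪g j, p⟫ = 0
        · filter_upwards [self_mem_nhdsWithin] with t ht
          rw [inner_add_right, inner_smul_right, hj, zero_add]
          exact mul_nonpos_of_nonneg_of_nonpos (le_of_lt ht) (hy j hj)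
        · have hlt : ⟪g j, p⟫ < 0 := lt_of_le_of_ne (hp j) hj
          have ct : ContinuousAt (fun t : ℝ => ⟪g j, p + t • y⟫) 0 := by fun_prop
          have := ct.eventually_lt_const (u := 0) (by simpa using hlt)
          filter_upwards [this.filter_mono nhdsWithin_le_nhds] with t ht using ht.le
      obtain ⟨t, ht, ht0⟩ := (evt.and self_mem_nhdsWithin).exists
      have h1 := var _ ht
      rw [add_sub_cancel_left, inner_smul_right] at h1
      rw [real_inner_smul_left]
      have ht0 : 0 < t := ht0
      have h2 : ⟪q - p, y⟫ ≤ 0 := by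
        by_contra! hc
        exact absurd h1 (not_le.2 (mul_pos ht0 hc))
      exact mul_nonpos_of_nonneg_of_nonpos (by positivity) h2)
  refine ⟨j, ?_⟩
  rw [inner_smul_right, inner_sub_right, show ⟪g j, p⟫ = 0 from hj, sub_zero, ← div_eq_inv_mul,
    le_div_iff₀ hn] at hj'
  exact hj'

end ErrorBound

/-! ### Pathwise estimates for one time slot. -/

section Queue

variable {n : ℕ}

theorem inner_eq_sum_mul (x y : Vec n) : ⟪x, y⟫ = ∑ i, x i * y i := by
  simp [PiLp.inner_apply, mul_comm]

theorem inner_nonneg_of_nonneg {x y : Vec n} (hx : ∀ i, 0 ≤ x i) (hy : ∀ i, 0 ≤ y i) :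
    0 ≤ ⟪x, y⟫ := by
  rw [inner_eq_sum_mul]
  exact Finset.sum_nonneg fun i _ => mul_nonneg (hx i) (hy i)

theorem norm_sq_eq_sum (x : Vec n) : ‖x‖ ^ 2 = ∑ i, x i ^ 2 := by
  rw [EuclideanSpace.real_norm_sq_eq]

theorem unusedService_apply (q a s : Vec n) (i : Fin n) :
    unusedService q a s i = s i - min (s i) (q i + a i) := rfl

theorem nextQueue_apply (q a s : Vec n) (i : Fin n) :
    nextQueue q a s i = max (q i + a i - s i) 0 := by
  have : nextQueue q a s i = q i + a i - s i + (s i - min (s i) (q i + a i)) := rfl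
  rw [this]
  rcases le_total (s i) (q i + a i) with h | h
  · rw [min_eq_left h, max_eq_left (by linarith)]; ring
  · rw [min_eq_right h, max_eq_right (by linarith)]; ring

theorem nextQueue_nonneg (q a s : Vec n) (i : Fin n) : 0 ≤ nextQueue q a s i := by
  rw [nextQueue_apply]; exact le_max_right _ _

theorem unusedService_nonneg (q a s : Vec n) (i : Fin n) : 0 ≤ unusedService q a s i := by
  rw [unusedService_apply]; linarith [min_le_left (s i) (q i + a i)]

theorem unusedService_le {q a s : Vec n} {i : Fin n} (hq : 0 ≤ q i) (ha : 0 ≤ a i)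
    (hs : 0 ≤ s i) : unusedService q a s i ≤ s i := by
  rw [unusedService_apply]
  have : 0 ≤ min (s i) (q i + a i) := le_min hs (by linarith)
  linarith

/-- The next queue and the unused service are the positive and negative parts of `q + a - s`; having
disjoint supports, they are orthogonal. -/
theorem norm_nextQueue_sq (q a s : Vec n) :
    ‖nextQueue q a s‖ ^ 2 = ‖q + a - s‖ ^ 2 - ‖unusedService q a s‖ ^ 2 := by
  simp only [norm_sq_eq_sum]
  rw [← Finset.sum_sub_distrib]
  refine Finset.sum_congr rfl fun i _ => ?_
  rw [nextQueue_apply, unusedService_apply]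
  simp only [PiLp.add_apply, PiLp.sub_apply]
  rcases le_total (s i) (q i + a i) with h | h
  · rw [min_eq_left h, max_eq_left (by linarith)]; ring
  · rw [min_eq_right h, max_eq_right (by linarith)]; ring

theorem norm_unusedService_le {q a s : Vec n} (hq : ∀ i, 0 ≤ q i) (ha : ∀ i, 0 ≤ a i)
    (hs : ∀ i, 0 ≤ s i) : ‖unusedService q a s‖ ≤ ‖s‖ := by
  refine le_of_sq_le_sq ?_ (norm_nonneg _)
  simp only [norm_sq_eq_sum]
  refine Finset.sum_le_sum fun i _ => ?_
  have := unusedService_nonneg q a s i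
  have := unusedService_le (hq i) (ha i) (hs i)
  gcongr

/-- Service is left unused only in a queue with `q i ≤ s i`, and the unused amount is at most `s i`.
-/
theorem inner_unusedService_le {q a s : Vec n} (hq : ∀ i, 0 ≤ q i) (ha : ∀ i, 0 ≤ a i)
    (hs : ∀ i, 0 ≤ s i) : ⟪q, unusedService q a s⟫ ≤ ‖s‖ ^ 2 := by
  rw [inner_eq_sum_mul, norm_sq_eq_sum]
  refine Finset.sum_le_sum fun i _ => ?_
  have h0 := unusedService_nonneg q a s i
  have h1 := unusedService_le (hq i) (ha i) (hs i)
  rw [unusedService_apply] at *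
  have := hq i
  have := ha i
  have := hs i
  rcases le_total (s i) (q i + a i) with h | h
  · rw [min_eq_left h]; nlinarith
  · rw [min_eq_right h] at *; nlinarith

/-- Turns a quadratic term into a linear one, whose stationary mean is known: coordinatewise `u² ≤ B
u ≤ (B / γ) c u`. -/
theorem norm_unusedService_sq_le {q a s c : Vec n} {γ B : ℝ} (hγ : 0 < γ)
    (hq : ∀ i, 0 ≤ q i) (ha : ∀ i, 0 ≤ a i) (hs : ∀ i, 0 ≤ s i) (hc : ∀ i, γ ≤ c i)
    (hB : ‖s‖ ≤ B) : ‖unusedService q a s‖ ^ 2 ≤ B / γ * ⟪c, unusedService q a s⟫ := by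
  rw [inner_eq_sum_mul, norm_sq_eq_sum, Finset.mul_sum]
  refine Finset.sum_le_sum fun i _ => ?_
  have h0 := unusedService_nonneg q a s i
  have h1 := unusedService_le (hq i) (ha i) (hs i)
  have h2 : s i ≤ B := (le_abs_self _).trans ((PiLp.norm_apply_le s i).trans hB)
  have h3 : 0 ≤ B := (norm_nonneg _).trans hB
  set t := unusedService q a s i
  calc t ^ 2 ≤ B * t := by nlinarith
    _ = B / γ * (γ * t) := by field_simp
    _ ≤ B / γ * (c i * t) := by gcongr; exact hc i

theorem continuous_unusedService_right (q s : Vec n) :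
    Continuous fun a : Vec n => unusedService q a s := by
  unfold unusedService
  refine (PiLp.continuous_toLp 2 _).comp ?_
  fun_prop

theorem continuous_nextQueue_right (q s : Vec n) :
    Continuous fun a : Vec n => nextQueue q a s := by
  have := continuous_unusedService_right q s
  unfold nextQueue
  fun_prop

end Queue

/-! ### Mean values over one slot under MaxWeight. -/

namespace GeneralizedSwitch

variable {n : ℕ} {M : Type*} [Fintype M] {G : GeneralizedSwitch n M}

theorem inner_le_maxRate {c x : Vec n} {m : M} (hx : x ∈ G.S m) : ⟪c, x⟫ ≤ G.maxRate c m :=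
  Finset.le_sup' (fun x => ⟪c, x⟫) hx

theorem exists_inner_eq_maxRate (G : GeneralizedSwitch n M) (c : Vec n) (m : M) :
    ∃ x ∈ G.S m, ⟪c, x⟫ = G.maxRate c m := by
  obtain ⟨x, hx, h⟩ := Finset.exists_mem_eq_sup' (G.S_nonempty m) fun x => ⟪c, x⟫
  exact ⟨x, hx, h.symm⟩

theorem MaxWeight.inner_eq_maxRate (R : G.MaxWeight) {q x : Vec n} {m : M} (hx : x ∈ G.S m)
    (h : R.prob q m x ≠ 0) : ⟪q, x⟫ = G.maxRate q m :=
  le_antisymm (inner_le_maxRate hx) (Finset.sup'_le _ _ (R.argmax q m x hx h))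

theorem continuous_maxRate (G : GeneralizedSwitch n M) (m : M) :
    Continuous fun c => G.maxRate c m := by
  unfold maxRate
  exact Continuous.finset_sup'_apply _ fun x _ => by fun_prop

theorem exists_norm_service_le (G : GeneralizedSwitch n M) :
    ∃ B : ℝ, 0 ≤ B ∧ ∀ m, ∀ x ∈ G.S m, ‖x‖ ≤ B := by
  refine ⟨∑ m, ∑ x ∈ G.S m, ‖x‖, by positivity, fun m x hx => ?_⟩
  calc ‖x‖ ≤ ∑ x ∈ G.S m, ‖x‖ :=
        Finset.single_le_sum (f := fun x => ‖x‖) (fun _ _ => norm_nonneg _) hx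
    _ ≤ _ := Finset.single_le_sum (f := fun m => ∑ x ∈ G.S m, ‖x‖)
        (fun _ _ => by positivity) (Finset.mem_univ m)

theorem channelMean_const (G : GeneralizedSwitch n M) (k : ℝ) : G.channelMean (fun _ => k) = k := by
  rw [channelMean, ← Finset.sum_mul, G.ψ_mem.2, one_mul]

theorem channelMean_mono (G : GeneralizedSwitch n M) {f g : M → ℝ} (h : ∀ m, f m ≤ g m) :
    G.channelMean f ≤ G.channelMean g :=
  Finset.sum_le_sum fun m _ => mul_le_mul_of_nonneg_left (h m) (G.ψ_mem.1 m)

theorem ψ_le_one (G : GeneralizedSwitch n M) (m : M) : G.ψ m ≤ 1 :=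
  G.ψ_mem.2 ▸ Finset.single_le_sum (fun m _ => G.ψ_mem.1 m) (Finset.mem_univ m)

/-- The expectation of a function of the channel state, the schedule and the arrivals in a time slot
that starts with queue lengths `q`. -/
noncomputable def stepMean (R : G.MaxWeight) (α : ProbabilityMeasure (Vec n)) (q : Vec n)
    (φ : M → Vec n → Vec n → ℝ) : ℝ :=
  ∑ m, ∑ x ∈ G.S m, G.ψ m * R.prob q m x * ∫ a, φ m x a ∂(α : Measure (Vec n))

variable {R : G.MaxWeight} {α : ProbabilityMeasure (Vec n)} {q : Vec n}
  {φ χ : M → Vec n → Vec n → ℝ}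

theorem stepMean_add (hφ : ∀ m, ∀ x ∈ G.S m, Integrable (φ m x) (α : Measure (Vec n)))
    (hχ : ∀ m, ∀ x ∈ G.S m, Integrable (χ m x) (α : Measure (Vec n))) :
    G.stepMean R α q (fun m x a => φ m x a + χ m x a) =
      G.stepMean R α q φ + G.stepMean R α q χ := by
  simp only [stepMean, ← Finset.sum_add_distrib]
  refine Finset.sum_congr rfl fun m _ => Finset.sum_congr rfl fun x hx => ?_
  rw [integral_add (hφ m x hx) (hχ m x hx), mul_add]

theorem stepMean_const_mul (k : ℝ) :
    G.stepMean R α q (fun m x a => k * φ m x a) = k * G.stepMean R α q φ := by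
  simp only [stepMean, Finset.mul_sum]
  refine Finset.sum_congr rfl fun m _ => Finset.sum_congr rfl fun x hx => ?_
  rw [integral_const_mul]; ring

theorem stepMean_sub (hφ : ∀ m, ∀ x ∈ G.S m, Integrable (φ m x) (α : Measure (Vec n)))
    (hχ : ∀ m, ∀ x ∈ G.S m, Integrable (χ m x) (α : Measure (Vec n))) :
    G.stepMean R α q (fun m x a => φ m x a - χ m x a) =
      G.stepMean R α q φ - G.stepMean R α q χ := by
  simp only [stepMean, ← Finset.sum_sub_distrib]
  refine Finset.sum_congr rfl fun m _ => Finset.sum_congr rfl fun x hx => ?_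
  rw [integral_sub (hφ m x hx) (hχ m x hx), mul_sub]

theorem stepMean_mono (hφ : ∀ m, ∀ x ∈ G.S m, Integrable (φ m x) (α : Measure (Vec n)))
    (hχ : ∀ m, ∀ x ∈ G.S m, Integrable (χ m x) (α : Measure (Vec n)))
    (h : ∀ m, G.ψ m ≠ 0 → ∀ x ∈ G.S m, ∀ᵐ a ∂(α : Measure (Vec n)), φ m x a ≤ χ m x a) :
    G.stepMean R α q φ ≤ G.stepMean R α q χ := by
  refine Finset.sum_le_sum fun m _ => Finset.sum_le_sum fun x hx => ?_
  by_cases h0 : G.ψ m = 0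
  · simp [h0]
  · exact mul_le_mul_of_nonneg_left (integral_mono_ae (hφ m x hx) (hχ m x hx) (h m h0 x hx))
      (mul_nonneg (G.ψ_mem.1 m) (R.prob_nonneg q m x))

theorem stepMean_arrival (f : Vec n → ℝ) :
    G.stepMean R α q (fun _ _ a => f a) = ∫ a, f a ∂(α : Measure (Vec n)) := by
  simp only [stepMean, ← Finset.sum_mul, ← Finset.mul_sum, R.sum_prob, mul_one, G.ψ_mem.2, one_mul]

theorem stepMean_channel (f : M → ℝ) :
    G.stepMean R α q (fun m _ _ => f m) = G.channelMean f := by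
  simp only [stepMean, channelMean, integral_const, probReal_univ, one_smul]
  refine Finset.sum_congr rfl fun m _ => ?_
  rw [← Finset.sum_mul, ← Finset.mul_sum, R.sum_prob, mul_one]

theorem stepMean_const (k : ℝ) : G.stepMean R α q (fun _ _ _ => k) = k := by
  rw [stepMean_channel, channelMean_const]

theorem stepMean_service (f : M → Vec n → ℝ) :
    G.stepMean R α q (fun m x _ => f m x) =
      ∑ m, ∑ x ∈ G.S m, G.ψ m * R.prob q m x * f m x := by
  simp [stepMean]

/-- Every schedule of positive probability is a maximizer, so the tie-breaking rule drops out. -/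
theorem stepMean_inner_self :
    G.stepMean R α q (fun _ x _ => ⟪q, x⟫) = G.channelMean (G.maxRate q) := by
  rw [← stepMean_channel (R := R) (α := α) (q := q), stepMean_service (fun _ x => ⟪q, x⟫),
    stepMean_service (fun m _ => G.maxRate q m)]
  refine Finset.sum_congr rfl fun m _ => Finset.sum_congr rfl fun x hx => ?_
  by_cases h : R.prob q m x = 0
  · simp [h]
  · rw [R.inner_eq_maxRate hx h]

theorem stepMean_inner_le (p : Vec n) :
    G.stepMean R α q (fun _ x _ => ⟪p, x⟫) ≤ G.channelMean (G.maxRate p) := by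
  rw [← stepMean_channel (R := R) (α := α) (q := q)]
  refine stepMean_mono (fun _ _ _ => integrable_const _) (fun _ _ _ => integrable_const _) ?_
  exact fun m _ x hx => ae_of_all _ fun _ => inner_le_maxRate hx

section Kernel

theorem queueKernel_apply : G.queueKernel R α q = ∑ m, ∑ x ∈ G.S m,
    ENNReal.ofReal (G.ψ m * R.prob q m x) •
      (α : Measure (Vec n)).map fun a => nextQueue q a x := rfl

theorem integrable_queueKernel {f : Vec n → ℝ} (hf : Measurable f)
    (hi : ∀ m, ∀ x ∈ G.S m, Integrable (fun a => f (nextQueue q a x)) (α : Measure (Vec n))) :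
    Integrable f (G.queueKernel R α q) := by
  rw [queueKernel_apply]
  refine integrable_finsetSum_measure.2 fun m _ => integrable_finsetSum_measure.2 fun x hx => ?_
  refine Integrable.smul_measure ?_ ENNReal.ofReal_ne_top
  exact (integrable_map_measure hf.aestronglyMeasurable
    (measurable_nextQueue_right q x).aemeasurable).2 (hi m x hx)

theorem integral_queueKernel {f : Vec n → ℝ} (hf : Measurable f)
    (hi : ∀ m, ∀ x ∈ G.S m, Integrable (fun a => f (nextQueue q a x)) (α : Measure (Vec n))) :
    ∫ y, f y ∂G.queueKernel R α q = G.stepMean R α q fun _ x a => f (nextQueue q a x) := by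
  have h1 : ∀ m, ∀ x ∈ G.S m, Integrable f (ENNReal.ofReal (G.ψ m * R.prob q m x) •
      (α : Measure (Vec n)).map fun a => nextQueue q a x) := fun m x hx =>
    Integrable.smul_measure ((integrable_map_measure hf.aestronglyMeasurable
      (measurable_nextQueue_right q x).aemeasurable).2 (hi m x hx)) ENNReal.ofReal_ne_top
  rw [queueKernel_apply, integral_finsetSum_measure fun m _ => integrable_finsetSum_measure.2 (h1 m)]
  refine Finset.sum_congr rfl fun m _ => ?_
  rw [integral_finsetSum_measure (h1 m)]
  refine Finset.sum_congr rfl fun x hx => ?_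
  rw [integral_smul_measure, ENNReal.toReal_ofReal
    (mul_nonneg (G.ψ_mem.1 m) (R.prob_nonneg q m x)), smul_eq_mul,
    integral_map (measurable_nextQueue_right q x).aemeasurable hf.aestronglyMeasurable]

/-- The chain lives on all of `Vec n`, but one step from any state lands in the orthant, so an
invariant law is carried by it. -/
theorem ae_nonneg_of_isSteadyState {π : ProbabilityMeasure (Vec n)} (h : G.IsSteadyState R α π) :
    ∀ᵐ q ∂(π : Measure (Vec n)), ∀ i, 0 ≤ q i := by
  have hm : MeasurableSet {q : Vec n | ∀ i, 0 ≤ q i}ᶜ := by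
    refine MeasurableSet.compl ?_
    simp only [Set.ofPred_forall]
    exact MeasurableSet.iInter fun i => measurableSet_le measurable_const (by fun_prop)
  have h' : (π : Measure (Vec n)).bind (G.queueKernel R α) = π := h
  rw [ae_iff]
  change (π : Measure (Vec n)) {q : Vec n | ∀ i, 0 ≤ q i}ᶜ = 0
  rw [← h', Measure.bind_apply hm (Kernel.aemeasurable _)]
  refine (lintegral_congr fun q => ?_).trans lintegral_zero
  simp only [queueKernel_apply, Measure.coe_finsetSum, Finset.sum_apply, Measure.smul_apply,
    smul_eq_mul]
  refine Finset.sum_eq_zero fun m _ => Finset.sum_eq_zero fun x _ => ?_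
  rw [Measure.map_apply (measurable_nextQueue_right q x) hm]
  have : (fun a => nextQueue q a x) ⁻¹' {q : Vec n | ∀ i, 0 ≤ q i}ᶜ = ∅ := by
    ext a
    simpa using nextQueue_nonneg q a x
  rw [this, measure_empty, mul_zero]

end Kernel

end GeneralizedSwitch

/-! ### Moments of bounded arrivals. -/

section Arrivals

variable {n : ℕ} {α : ProbabilityMeasure (Vec n)} {A : ℝ}

theorem BoundedArrivals.ae_norm_le (h : BoundedArrivals α A) :
    ∀ᵐ a ∂(α : Measure (Vec n)), ‖a‖ ≤ n * |A| := by
  filter_upwards [h] with a ha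
  refine le_of_sq_le_sq ?_ (by positivity)
  rw [norm_sq_eq_sum]
  have h1 : ∀ i ∈ Finset.univ, a i ^ 2 ≤ |A| ^ 2 := fun i _ => by
    rw [sq_abs]
    exact pow_le_pow_left₀ (ha i).1 (ha i).2 2
  refine (Finset.sum_le_sum h1).trans ?_
  rw [Finset.sum_const, Finset.card_univ, Fintype.card_fin, nsmul_eq_mul, mul_pow]
  have h2 : (n : ℝ) ≤ n ^ 2 := by exact_mod_cast Nat.le_self_pow (by norm_num) n
  gcongr

theorem BoundedArrivals.integrable (h : BoundedArrivals α A) {f : Vec n → ℝ} (hf : Continuous f) :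
    Integrable f (α : Measure (Vec n)) := by
  obtain ⟨C, hC⟩ := (isCompact_closedBall (0 : Vec n) (n * |A|)).exists_bound_of_continuousOn
    hf.continuousOn
  refine Integrable.of_bound hf.measurable.aestronglyMeasurable C ?_
  filter_upwards [h.ae_norm_le] with a ha
  exact hC a (by simpa using ha)

theorem BoundedArrivals.integral_inner (h : BoundedArrivals α A) {e : Vec n}
    (he : ∀ i, ∫ a, a i ∂(α : Measure (Vec n)) = e i) (v : Vec n) :
    ∫ a, ⟪v, a⟫ ∂(α : Measure (Vec n)) = ⟪v, e⟫ := by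
  simp only [inner_eq_sum_mul]
  rw [integral_finsetSum _ fun i _ => h.integrable (by fun_prop)]
  simp only [integral_const_mul, he]

/-- The arrivals enter the second order term only through this trace, which is why their
correlations do not affect the limit. -/
theorem BoundedArrivals.integral_norm_sub_sq (h : BoundedArrivals α A) {e : Vec n}
    (he : ∀ i, ∫ a, a i ∂(α : Measure (Vec n)) = e i) :
    ∫ a, ‖a - e‖ ^ 2 ∂(α : Measure (Vec n)) = ∑ i, arrivalCov α i i := by
  simp only [norm_sq_eq_sum, PiLp.sub_apply]
  rw [integral_finsetSum _ fun i _ => h.integrable (by fun_prop)]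
  refine Finset.sum_congr rfl fun i _ => ?_
  simp only [arrivalCov, Matrix.of_apply, covariance, he, sq]

theorem BoundedArrivals.integral_norm_sub_const_sq (h : BoundedArrivals α A) {e : Vec n}
    (he : ∀ i, ∫ a, a i ∂(α : Measure (Vec n)) = e i) (x : Vec n) :
    ∫ a, ‖a - x‖ ^ 2 ∂(α : Measure (Vec n)) = ∑ i, arrivalCov α i i + ‖x - e‖ ^ 2 := by
  have h1 : ∀ a : Vec n, ‖a - x‖ ^ 2 =
      ‖a - e‖ ^ 2 + (-2 * ⟪x - e, a⟫ + (2 * ⟪x - e, e⟫ + ‖x - e‖ ^ 2)) := fun a => by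
    have : a - x = (a - e) - (x - e) := by abel
    rw [this, norm_sub_sq_real, real_inner_comm, inner_sub_right]
    ring
  simp only [h1]
  rw [integral_add (h.integrable (by fun_prop)) (h.integrable (by fun_prop)),
    integral_add (h.integrable (by fun_prop)) (integrable_const _), integral_const_mul,
    h.integral_inner he, h.integral_norm_sub_sq he]
  simp

end Arrivals

attribute [fun_prop] continuous_unusedService_right continuous_nextQueue_right

/-! ### Exposed vertices, slack and loss. -/

namespace GeneralizedSwitch

variable {n : ℕ} {M : Type*} [Fintype M] {G : GeneralizedSwitch n M}

/-- `c` is a positive vector such that, in every channel state `m` of positive probability, `V m` is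
the only maximizer of `⟪c, ·⟫` over the feasible schedules, and `ν` is the mean of `V`. -/
structure ExposedVertex (G : GeneralizedSwitch n M) (ν c : Vec n) (V : M → Vec n) : Prop where
  mem : ∀ m, V m ∈ G.S m
  sum_eq : ∑ m, G.ψ m • V m = ν
  pos : ∀ i, 0 < c i
  lt : ∀ m, G.ψ m ≠ 0 → ∀ x ∈ G.S m, x ≠ V m → ⟪c, x⟫ < ⟪c, V m⟫

/-- The amount by which the largest `q`-weighted rate in the capacity region exceeds that of `ν`. -/
noncomputable def slack (G : GeneralizedSwitch n M) (ν q : Vec n) : ℝ := G.channelMean (G.maxRate q) - ⟪q, ν⟫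

/-- The mean `c`-weighted service that is lost in a time slot, by not using the schedule `V m` or by
not using all of the chosen schedule. -/
noncomputable def loss (R : G.MaxWeight) (α : ProbabilityMeasure (Vec n)) (c : Vec n) (V : M → Vec n)
    (q : Vec n) : ℝ :=
  G.stepMean R α q fun m x a => ⟪c, V m - x⟫ + ⟪c, unusedService q a x⟫

/-- The mean of the second order term in the drift of the squared norm. -/
noncomputable def secondOrder (R : G.MaxWeight) (α : ProbabilityMeasure (Vec n)) (q : Vec n) : ℝ :=
  G.stepMean R α q fun _ x a => ‖a - x‖ ^ 2 - ‖unusedService q a x‖ ^ 2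

theorem continuous_slack (G : GeneralizedSwitch n M) (ν : Vec n) : Continuous (G.slack ν) := by
  unfold slack channelMean
  have := G.continuous_maxRate
  fun_prop

variable {R : G.MaxWeight} {α : ProbabilityMeasure (Vec n)} {A : ℝ} {q ν c e : Vec n} {V : M → Vec n}

theorem integrable_comp_nextQueue (hA : BoundedArrivals α A) {f : Vec n → ℝ} (hf : Continuous f)
    (x : Vec n) : Integrable (fun a => f (nextQueue q a x)) (α : Measure (Vec n)) :=
  hA.integrable (by fun_prop)

theorem integral_norm_sq_queueKernel (hA : BoundedArrivals α A)
    (he : ∀ i, ∫ a, a i ∂(α : Measure (Vec n)) = e i) :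
    ∫ y, ‖y‖ ^ 2 ∂G.queueKernel R α q =
      ‖q‖ ^ 2 + 2 * (⟪q, e⟫ - G.channelMean (G.maxRate q)) + G.secondOrder R α q := by
  have hc : Continuous fun y : Vec n => ‖y‖ ^ 2 := by fun_prop
  rw [integral_queueKernel hc.measurable fun _ x _ => integrable_comp_nextQueue hA hc _]
  have h1 : ∀ x a : Vec n, ‖nextQueue q a x‖ ^ 2 = ‖q‖ ^ 2 + (2 * ⟪q, a⟫ - 2 * ⟪q, x⟫) +
      (‖a - x‖ ^ 2 - ‖unusedService q a x‖ ^ 2) := fun x a => by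
    rw [norm_nextQueue_sq, add_sub_assoc, norm_add_sq_real, inner_sub_right]
    ring
  simp only [h1]
  rw [stepMean_add (fun _ _ _ => hA.integrable (by fun_prop))
      (fun _ _ _ => hA.integrable (by fun_prop)),
    stepMean_add (fun _ _ _ => hA.integrable (by fun_prop))
      (fun _ _ _ => hA.integrable (by fun_prop)),
    stepMean_sub (fun _ _ _ => hA.integrable (by fun_prop))
      (fun _ _ _ => hA.integrable (by fun_prop)),
    stepMean_const, stepMean_const_mul, stepMean_const_mul, stepMean_inner_self,
    stepMean_arrival (fun a => ⟪q, a⟫), hA.integral_inner he]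
  unfold secondOrder
  ring

theorem ExposedVertex.channelMean_inner (hV : G.ExposedVertex ν c V) (v : Vec n) :
    G.channelMean (fun m => ⟪v, V m⟫) = ⟪v, ν⟫ := by
  rw [← hV.sum_eq, inner_sum]
  simp only [channelMean, inner_smul_right]

theorem ExposedVertex.slack_nonneg (hV : G.ExposedVertex ν c V) (q : Vec n) : 0 ≤ G.slack ν q := by
  rw [slack, ← hV.channelMean_inner, sub_nonneg]
  exact G.channelMean_mono fun m => inner_le_maxRate (hV.mem m)

theorem ExposedVertex.integral_inner_queueKernel (hV : G.ExposedVertex ν c V)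
    (hA : BoundedArrivals α A) (he : ∀ i, ∫ a, a i ∂(α : Measure (Vec n)) = e i) :
    ∫ y, ⟪c, y⟫ ∂G.queueKernel R α q = ⟪c, q⟫ + (⟪c, e⟫ - ⟪c, ν⟫) + G.loss R α c V q := by
  have hc : Continuous fun y : Vec n => ⟪c, y⟫ := by fun_prop
  rw [integral_queueKernel hc.measurable fun _ x _ => integrable_comp_nextQueue hA hc _,
    ← hV.channelMean_inner, ← stepMean_channel (R := R) (α := α) (q := q),
    ← hA.integral_inner he, ← stepMean_arrival (G := G) (R := R) (q := q),
    ← stepMean_const (G := G) (R := R) (α := α) (q := q) ⟪c, q⟫, loss,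
    ← stepMean_sub (fun _ _ _ => hA.integrable (by fun_prop))
      (fun _ _ _ => hA.integrable (by fun_prop)),
    ← stepMean_add (fun _ _ _ => hA.integrable (by fun_prop))
      (fun _ _ _ => hA.integrable (by fun_prop)),
    ← stepMean_add (fun _ _ _ => hA.integrable (by fun_prop))
      (fun _ _ _ => hA.integrable (by fun_prop))]
  congr 1
  funext m x a
  simp only [nextQueue, inner_add_right, inner_sub_right]
  ring

/-- Choosing `γ` small enough, instead of as a minimum, also covers `n = 0`. -/
theorem ExposedVertex.exists_pos_le (hV : G.ExposedVertex ν c V) : ∃ γ > 0, ∀ i, γ ≤ c i := by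
  have : ∀ᶠ γ in 𝓝[>] (0 : ℝ), ∀ i, γ ≤ c i := eventually_all.2 fun i => by
    filter_upwards [Ioo_mem_nhdsGT (hV.pos i)] with γ h using h.2.le
  obtain ⟨γ, h, h0⟩ := (this.and self_mem_nhdsWithin).exists
  exact ⟨γ, h0, h⟩

/-- The weight `ψ m` is included because a wrong schedule in the single state `m` contributes to the
mean loss with this weight. -/
theorem ExposedVertex.exists_gap (hV : G.ExposedVertex ν c V) :
    ∃ η > 0, ∀ m, G.ψ m ≠ 0 → ∀ x ∈ G.S m, x ≠ V m → η ≤ G.ψ m * ⟪c, V m - x⟫ := by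
  have : ∀ᶠ η in 𝓝[>] (0 : ℝ), ∀ m, ∀ x ∈ G.S m, G.ψ m ≠ 0 → x ≠ V m →
      η ≤ G.ψ m * ⟪c, V m - x⟫ := by
    refine eventually_all.2 fun m => (Finset.eventually_all _).2 fun x hx => ?_
    by_cases h : G.ψ m ≠ 0 ∧ x ≠ V m
    · have h1 : 0 < G.ψ m * ⟪c, V m - x⟫ := by
        rw [inner_sub_right]
        exact mul_pos (lt_of_le_of_ne (G.ψ_mem.1 m) h.1.symm)
          (sub_pos.2 (hV.lt m h.1 x hx h.2))
      filter_upwards [Ioo_mem_nhdsGT h1] with η h _ _ using h.2.le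
    · exact Eventually.of_forall fun η h1 h2 => absurd ⟨h1, h2⟩ h
  obtain ⟨η, h, h0⟩ := (this.and self_mem_nhdsWithin).exists
  exact ⟨η, h0, fun m hm x hx hxV => h m x hx hm hxV⟩

theorem ExposedVertex.inner_sub_nonneg (hV : G.ExposedVertex ν c V) {m : M} (hm : G.ψ m ≠ 0)
    {x : Vec n} (hx : x ∈ G.S m) : 0 ≤ ⟪c, V m - x⟫ := by
  by_cases h : x = V m
  · simp [h]
  · rw [inner_sub_right]
    exact (sub_pos.2 (hV.lt m hm x hx h)).le

theorem ExposedVertex.inner_unusedService_nonneg (hV : G.ExposedVertex ν c V) (q a x : Vec n) :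
    0 ≤ ⟪c, unusedService q a x⟫ :=
  inner_nonneg_of_nonneg (fun i => (hV.pos i).le) (unusedService_nonneg q a x)

theorem ExposedVertex.stepMean_service_le_loss (hV : G.ExposedVertex ν c V)
    (hA : BoundedArrivals α A) :
    G.stepMean R α q (fun m x _ => ⟪c, V m - x⟫) ≤ G.loss R α c V q :=
  stepMean_mono (fun _ _ _ => hA.integrable (by fun_prop))
    (fun _ _ _ => hA.integrable (by fun_prop)) fun m _ x _ => ae_of_all _ fun a => by
      linarith [hV.inner_unusedService_nonneg q a x]

theorem ExposedVertex.loss_nonneg (hV : G.ExposedVertex ν c V) (hA : BoundedArrivals α A) :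
    0 ≤ G.loss R α c V q := by
  rw [← stepMean_const (G := G) (R := R) (α := α) (q := q) 0]
  refine (stepMean_mono (fun _ _ _ => integrable_const _) (fun _ _ _ => integrable_const _) ?_).trans
    (hV.stepMean_service_le_loss hA)
  exact fun m hm x hx => ae_of_all _ fun _ => hV.inner_sub_nonneg hm hx

/-- If the slack is positive, then a wrong schedule is used in some channel state. -/
theorem ExposedVertex.le_loss_of_slack_pos (hV : G.ExposedVertex ν c V) (hA : BoundedArrivals α A)
    {η : ℝ} (hη : ∀ m, G.ψ m ≠ 0 → ∀ x ∈ G.S m, x ≠ V m → η ≤ G.ψ m * ⟪c, V m - x⟫)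
    (hq : 0 < G.slack ν q) : η ≤ G.loss R α c V q := by
  refine le_trans ?_ (hV.stepMean_service_le_loss hA)
  rw [slack, ← hV.channelMean_inner, channelMean, channelMean, ← Finset.sum_sub_distrib] at hq
  obtain ⟨m, -, hm⟩ := Finset.exists_lt_of_sum_lt (s := Finset.univ) (f := fun _ => (0 : ℝ))
    (g := fun m => G.ψ m * G.maxRate q m - G.ψ m * ⟪q, V m⟫) (by simpa using hq)
  rw [← mul_sub] at hm
  have h0 : G.ψ m ≠ 0 := fun h => by simp [h] at hm
  -- In this state `V m` does not maximize `⟪q, ·⟫`, so MaxWeight never picks it, and every schedule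
  -- it picks costs at least `η`.
  have hp : R.prob q m (V m) = 0 := by
    by_contra h
    rw [R.inner_eq_maxRate (hV.mem m) h] at hm
    simp at hm
  rw [stepMean_service fun m x => ⟪c, V m - x⟫]
  calc η = ∑ x ∈ G.S m, R.prob q m x * η := by rw [← Finset.sum_mul, R.sum_prob, one_mul]
    _ ≤ ∑ x ∈ G.S m, G.ψ m * R.prob q m x * ⟪c, V m - x⟫ := by
        refine Finset.sum_le_sum fun x hx => ?_
        by_cases h : x = V m
        · simp [h, hp]
        · have := mul_le_mul_of_nonneg_left (hη m h0 x hx h) (R.prob_nonneg q m x)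
          linarith
    _ ≤ _ := by
        refine Finset.single_le_sum
          (f := fun m => ∑ x ∈ G.S m, G.ψ m * R.prob q m x * ⟪c, V m - x⟫) ?_ (Finset.mem_univ m)
        refine fun m _ => Finset.sum_nonneg fun x hx => ?_
        by_cases h : G.ψ m = 0
        · simp [h]
        · exact mul_nonneg (mul_nonneg (G.ψ_mem.1 m) (R.prob_nonneg q m x))
            (hV.inner_sub_nonneg h hx)

/-- If `V m` is always chosen and fully used, the difference is zero. A wrong schedule changes the
squared norm by at most `(B + ‖ν‖)²` and costs at least `η`; unused service is handled by
`norm_unusedService_sq_le`. -/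
theorem ExposedVertex.abs_secondOrder_sub_le (hV : G.ExposedVertex ν c V)
    (hA : BoundedArrivals α A) (he : ∀ i, ∫ a, a i ∂(α : Measure (Vec n)) = e i)
    {γ η B : ℝ} (hγ : 0 < γ) (hγc : ∀ i, γ ≤ c i) (hη0 : 0 < η)
    (hη : ∀ m, G.ψ m ≠ 0 → ∀ x ∈ G.S m, x ≠ V m → η ≤ G.ψ m * ⟪c, V m - x⟫)
    (hB : ∀ m, ∀ x ∈ G.S m, ‖x‖ ≤ B) (heν : ‖e‖ ≤ ‖ν‖) (hq : ∀ i, 0 ≤ q i) :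
    |G.secondOrder R α q - (∑ i, arrivalCov α i i + G.channelMean fun m => ‖V m - e‖ ^ 2)| ≤
      ((B + ‖ν‖) ^ 2 / η + B / γ) * G.loss R α c V q := by
  have e1 : G.stepMean R α q (fun _ x a => ‖a - x‖ ^ 2) =
      G.stepMean R α q (fun _ x _ => ∑ i, arrivalCov α i i + ‖x - e‖ ^ 2) := by
    unfold stepMean
    simp [hA.integral_norm_sub_const_sq he]
  have e2 : G.secondOrder R α q - (∑ i, arrivalCov α i i + G.channelMean fun m => ‖V m - e‖ ^ 2) =
      G.stepMean R α q fun m x a => (‖x - e‖ ^ 2 - ‖V m - e‖ ^ 2) -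
        ‖unusedService q a x‖ ^ 2 := by
    rw [secondOrder, stepMean_sub (fun _ _ _ => hA.integrable (by fun_prop))
        (fun _ _ _ => hA.integrable (by fun_prop)), e1,
      stepMean_add (fun _ _ _ => hA.integrable (by fun_prop))
        (fun _ _ _ => hA.integrable (by fun_prop)), stepMean_const,
      stepMean_sub (fun _ _ _ => hA.integrable (by fun_prop))
        (fun _ _ _ => hA.integrable (by fun_prop)),
      stepMean_sub (fun _ _ _ => hA.integrable (by fun_prop))
        (fun _ _ _ => hA.integrable (by fun_prop)),
      stepMean_channel fun m => ‖V m - e‖ ^ 2]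
    ring
  have e3 : ∀ k : ℝ, k * G.loss R α c V q = G.stepMean R α q fun m x a =>
      k * (⟪c, V m - x⟫ + ⟪c, unusedService q a x⟫) := fun k => (stepMean_const_mul k).symm
  have key : ∀ m, G.ψ m ≠ 0 → ∀ x ∈ G.S m, ∀ᵐ a ∂(α : Measure (Vec n)),
      |(‖x - e‖ ^ 2 - ‖V m - e‖ ^ 2) - ‖unusedService q a x‖ ^ 2| ≤
        ((B + ‖ν‖) ^ 2 / η + B / γ) * (⟪c, V m - x⟫ + ⟪c, unusedService q a x⟫) := by
    intro m hm x hx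
    filter_upwards [hA] with a ha
    have hB0 : 0 ≤ B := (norm_nonneg _).trans (hB m x hx)
    have n1 : ∀ y ∈ G.S m, ‖y - e‖ ^ 2 ≤ (B + ‖ν‖) ^ 2 := fun y hy => by
      have := norm_sub_le y e
      have := hB m y hy
      exact pow_le_pow_left₀ (norm_nonneg _) (by linarith) 2
    have s1 : |‖x - e‖ ^ 2 - ‖V m - e‖ ^ 2| ≤ (B + ‖ν‖) ^ 2 / η * ⟪c, V m - x⟫ := by
      by_cases h : x = V m
      · simp [h]
      · have h1 := hη m hm x hx h
        have h2 := hV.inner_sub_nonneg hm hx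
        have h3 : η ≤ ⟪c, V m - x⟫ :=
          h1.trans (mul_le_of_le_one_left h2 (G.ψ_le_one m))
        have h4 : (B + ‖ν‖) ^ 2 ≤ (B + ‖ν‖) ^ 2 / η * ⟪c, V m - x⟫ := by
          rw [div_mul_eq_mul_div, le_div_iff₀ hη0]
          exact mul_le_mul_of_nonneg_left h3 (sq_nonneg _)
        refine le_trans (abs_le.2 ⟨?_, ?_⟩) h4
        · have := n1 _ (hV.mem m); have := sq_nonneg ‖x - e‖; linarith
        · have := n1 _ hx; have := sq_nonneg ‖V m - e‖; linarith
    have s2 : ‖unusedService q a x‖ ^ 2 ≤ B / γ * ⟪c, unusedService q a x⟫ :=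
      norm_unusedService_sq_le hγ hq (fun i => (ha i).1) (G.S_nonneg m x hx) hγc (hB m x hx)
    have s3 : 0 ≤ (B + ‖ν‖) ^ 2 / η * ⟪c, unusedService q a x⟫ :=
      mul_nonneg (by positivity) (hV.inner_unusedService_nonneg q a x)
    have s4 : 0 ≤ B / γ * ⟪c, V m - x⟫ :=
      mul_nonneg (by positivity) (hV.inner_sub_nonneg hm hx)
    have s5 := abs_sub (‖x - e‖ ^ 2 - ‖V m - e‖ ^ 2) (‖unusedService q a x‖ ^ 2)
    rw [abs_of_nonneg (sq_nonneg ‖unusedService q a x‖)] at s5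
    linarith
  rw [e2, abs_le]
  constructor
  · rw [← neg_mul, e3]
    refine stepMean_mono (fun _ _ _ => hA.integrable (by fun_prop))
      (fun _ _ _ => hA.integrable (by fun_prop)) fun m hm x hx => ?_
    filter_upwards [key m hm x hx] with a ha
    rw [neg_mul]; exact (abs_le.1 ha).1
  · rw [e3]
    refine stepMean_mono (fun _ _ _ => hA.integrable (by fun_prop))
      (fun _ _ _ => hA.integrable (by fun_prop)) fun m hm x hx => ?_
    filter_upwards [key m hm x hx] with a ha using (abs_le.1 ha).2

/-! ### The collapse cone and the drift of the distance to it. -/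

section Collapse

/-- The generators of the polar of the set of nonnegative queue lengths with zero slack. -/
noncomputable def collapseGenerator (G : GeneralizedSwitch n M) (ν : Vec n) :
    (∀ m, G.S m) ⊕ Fin n → Vec n
  | Sum.inl f => ∑ m, G.ψ m • (f m : Vec n) - ν
  | Sum.inr i => -EuclideanSpace.single i 1

/-- The cone of nonnegative queue lengths with zero slack. -/
noncomputable def collapseCone (G : GeneralizedSwitch n M) (ν : Vec n) : Set (Vec n) :=
  polyhedralCone (G.collapseGenerator ν)

theorem inner_collapseGenerator_inl_le (f : ∀ m, G.S m) (q : Vec n) :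
    ⟪G.collapseGenerator ν (Sum.inl f), q⟫ ≤ G.slack ν q := by
  rw [real_inner_comm, collapseGenerator, inner_sub_right, inner_sum, slack]
  simp only [inner_smul_right]
  have := G.channelMean_mono fun m => inner_le_maxRate (c := q) (f m).2
  unfold channelMean at *
  linarith

/-- With the preceding inequality, this makes the slack a maximum of finitely many linear forms, one
for each choice of a schedule in every state. -/
theorem exists_inner_collapseGenerator_eq (G : GeneralizedSwitch n M) (ν q : Vec n) :
    ∃ f : ∀ m, G.S m, ⟪G.collapseGenerator ν (Sum.inl f), q⟫ = G.slack ν q := by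
  choose x hx h using G.exists_inner_eq_maxRate q
  refine ⟨fun m => ⟨x m, hx m⟩, ?_⟩
  rw [real_inner_comm, collapseGenerator, inner_sub_right, inner_sum, slack]
  simp only [inner_smul_right, h, channelMean]

theorem nonneg_of_mem_collapseCone {p : Vec n} (hp : p ∈ G.collapseCone ν) (i : Fin n) :
    0 ≤ p i := by
  have := hp (Sum.inr i)
  simpa [collapseGenerator, inner_neg_left, EuclideanSpace.inner_single_left] using this

theorem slack_nonpos_of_mem_collapseCone {p : Vec n} (hp : p ∈ G.collapseCone ν) :
    G.slack ν p ≤ 0 := by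
  obtain ⟨f, hf⟩ := G.exists_inner_collapseGenerator_eq ν p
  exact hf ▸ hp (Sum.inl f)

/-- The linear form attaining the slack at `q` is nonpositive at `p` and has norm at most `B + ‖ν‖`.
-/
theorem slack_le_mul_norm {B : ℝ} (hB : ∀ m, ∀ x ∈ G.S m, ‖x‖ ≤ B) {p : Vec n}
    (hp : p ∈ G.collapseCone ν) (q : Vec n) : G.slack ν q ≤ (B + ‖ν‖) * ‖q - p‖ := by
  obtain ⟨f, hf⟩ := G.exists_inner_collapseGenerator_eq ν q
  have h1 : ‖G.collapseGenerator ν (Sum.inl f)‖ ≤ B + ‖ν‖ := by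
    refine (norm_sub_le _ _).trans (add_le_add_left ?_ _)
    calc ‖∑ m, G.ψ m • (f m : Vec n)‖ ≤ ∑ m, G.ψ m * B := by
          refine norm_sum_le_of_le _ fun m _ => ?_
          rw [norm_smul, Real.norm_of_nonneg (G.ψ_mem.1 m)]
          exact mul_le_mul_of_nonneg_left (hB m _ (f m).2) (G.ψ_mem.1 m)
      _ = B := by rw [← Finset.sum_mul, G.ψ_mem.2, one_mul]
  have h2 := hp (Sum.inl f)
  calc G.slack ν q = ⟪G.collapseGenerator ν (Sum.inl f), q - p⟫ +
        ⟪G.collapseGenerator ν (Sum.inl f), p⟫ := by rw [← inner_add_right, sub_add_cancel, hf]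
    _ ≤ ⟪G.collapseGenerator ν (Sum.inl f), q - p⟫ := by linarith
    _ ≤ ‖G.collapseGenerator ν (Sum.inl f)‖ * ‖q - p‖ := real_inner_le_norm _ _
    _ ≤ _ := by gcongr

/-- The generator from Hoffman's bound is dominated by the slack: schedule generators always are,
and `-q i ≤ 0` for `q` in the orthant. -/
theorem ExposedVertex.exists_error_bound (hV : G.ExposedVertex ν c V) :
    ∃ δ > 0, ∀ q : Vec n, (∀ i, 0 ≤ q i) → ∃ p ∈ G.collapseCone ν,
      Metric.infDist q (G.collapseCone ν) = ‖q - p‖ ∧ δ * ‖q - p‖ ≤ G.slack ν q := by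
  classical
  obtain ⟨δ, hδ, h⟩ := exists_polyhedralCone_error_bound (G.collapseGenerator ν)
  refine ⟨δ, hδ, fun q hq => ?_⟩
  obtain ⟨p, hp, hd, hcase⟩ := h q
  refine ⟨p, hp, hd, ?_⟩
  rcases hcase with rfl | ⟨f | i, hj⟩
  · simpa using hV.slack_nonneg q
  · exact hj.trans (inner_collapseGenerator_inl_le f q)
  · refine hj.trans (le_trans ?_ (hV.slack_nonneg q))
    simpa [collapseGenerator, inner_neg_left, EuclideanSpace.inner_single_left] using hq i

/-- One step of the fourth power of the distance to the collapse cone. -/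
theorem integral_infDist_pow_four_le (hA : BoundedArrivals α A) {ε δ B K₀ : ℝ}
    (he : ∀ i, ∫ a, a i ∂(α : Measure (Vec n)) = ((1 - ε) • ν) i)
    (hB : ∀ m, ∀ x ∈ G.S m, ‖x‖ ≤ B) (hε : 0 ≤ ε) (hδ : ε * ‖ν‖ ≤ δ / 2) {p : Vec n}
    (hK₀ : 2 * B ^ 2 + (n * |A| + 2 * B) ^ 2 ≤ K₀)
    (hp : p ∈ G.collapseCone ν) (hps : δ * ‖q - p‖ ≤ G.slack ν q) (hq : ∀ i, 0 ≤ q i) :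
    ∫ y, Metric.infDist y (G.collapseCone ν) ^ 4 ∂G.queueKernel R α q ≤
      ‖q - p‖ ^ 4 + 2 * ‖q - p‖ ^ 2 * (K₀ - δ * ‖q - p‖) +
        (2 * (n * |A| + B) * ‖q - p‖ + K₀) ^ 2 := by
  set w := ‖q - p‖ with hw
  have hw0 : 0 ≤ w := norm_nonneg _
  have hB0 : 0 ≤ B := by
    obtain ⟨m⟩ : Nonempty M := by
      by_contra hM
      rw [not_nonempty_iff] at hM
      have := G.ψ_mem.2
      simp at this
    obtain ⟨x, hx⟩ := G.S_nonempty m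
    exact (norm_nonneg _).trans (hB m x hx)
  have hK0 : 0 ≤ K₀ := le_trans (by positivity) hK₀
  have hc : Continuous fun y => Metric.infDist y (G.collapseCone ν) ^ 4 :=
    (Metric.continuous_infDist_pt _).pow 4
  rw [integral_queueKernel hc.measurable fun _ x _ => integrable_comp_nextQueue hA hc _]
  -- An upper bound for the increment of `‖q - p‖²` with `p` kept fixed. `K₀` absorbs `2⟪q, u⟫ ≤ 2
  -- B²` and the squared displacement; `⟪p, u⟫ ≥ 0` has the favourable sign.
  set D : Vec n → Vec n → ℝ := fun x a => 2 * ⟪q - p, a⟫ - 2 * ⟪q - p, x⟫ + K₀ with hD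
  have step : ∀ m, ∀ x ∈ G.S m, ∀ᵐ a ∂(α : Measure (Vec n)),
      Metric.infDist (nextQueue q a x) (G.collapseCone ν) ^ 4 ≤
        w ^ 4 + 2 * w ^ 2 * D x a + (2 * (n * |A| + B) * w + K₀) ^ 2 := by
    intro m x hx
    filter_upwards [hA, hA.ae_norm_le] with a ha hna
    have hx0 := G.S_nonneg m x hx
    have hxB := hB m x hx
    have ha0 : ∀ i, 0 ≤ a i := fun i => (ha i).1
    have h1 : Metric.infDist (nextQueue q a x) (G.collapseCone ν) ≤ ‖nextQueue q a x - p‖ := by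
      rw [← dist_eq_norm]; exact Metric.infDist_le_dist_of_mem hp
    have h2 : ‖nextQueue q a x - p‖ ^ 2 ≤ w ^ 2 + D x a := by
      have e1 : nextQueue q a x - p = (q - p) + (a - x + unusedService q a x) := by
        rw [nextQueue]; abel
      have u1 := inner_unusedService_le hq ha0 hx0
      have u2 : 0 ≤ ⟪p, unusedService q a x⟫ :=
        inner_nonneg_of_nonneg (nonneg_of_mem_collapseCone hp) (unusedService_nonneg q a x)
      have u3 := norm_unusedService_le hq ha0 hx0
      have u4 : ‖a - x + unusedService q a x‖ ^ 2 ≤ (n * |A| + 2 * B) ^ 2 := by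
        refine pow_le_pow_left₀ (norm_nonneg _) ?_ 2
        have := norm_add_le (a - x) (unusedService q a x)
        have := norm_sub_le a x
        linarith
      have u5 : ‖x‖ ^ 2 ≤ B ^ 2 := pow_le_pow_left₀ (norm_nonneg _) hxB 2
      rw [e1, norm_add_sq_real, inner_add_right, inner_sub_right,
        inner_sub_left q p (unusedService q a x)]
      simp only [hD]
      linarith
    have h3 : |D x a| ≤ 2 * (n * |A| + B) * w + K₀ := by
      have v1 := abs_real_inner_le_norm (q - p) (a - x)
      have v2 : ‖a - x‖ ≤ n * |A| + B := (norm_sub_le a x).trans (by linarith)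
      have v3 : ‖q - p‖ * ‖a - x‖ ≤ w * (n * |A| + B) := by gcongr
      have v4 : D x a = 2 * ⟪q - p, a - x⟫ + K₀ := by rw [inner_sub_right]; simp only [hD]; ring
      rw [v4]
      refine (abs_add_le _ _).trans ?_
      rw [abs_mul, abs_of_nonneg hK0, abs_two]
      linarith
    have h4 : Metric.infDist (nextQueue q a x) (G.collapseCone ν) ^ 2 ≤ w ^ 2 + D x a :=
      (pow_le_pow_left₀ Metric.infDist_nonneg h1 2).trans h2
    have h5 : D x a ^ 2 ≤ (2 * (n * |A| + B) * w + K₀) ^ 2 := by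
      rw [← sq_abs (D x a)]
      exact pow_le_pow_left₀ (abs_nonneg _) h3 2
    calc Metric.infDist (nextQueue q a x) (G.collapseCone ν) ^ 4
        = (Metric.infDist (nextQueue q a x) (G.collapseCone ν) ^ 2) ^ 2 := by ring
      _ ≤ (w ^ 2 + D x a) ^ 2 := pow_le_pow_left₀ (sq_nonneg _) h4 2
      _ = w ^ 4 + 2 * w ^ 2 * D x a + D x a ^ 2 := by ring
      _ ≤ _ := by linarith
  have hcD : ∀ x, Continuous (D x) := fun x => by fun_prop
  have hcn : ∀ x, Continuous fun a =>
      Metric.infDist (nextQueue q a x) (G.collapseCone ν) ^ 4 := fun x =>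
    hc.comp (continuous_nextQueue_right q x)
  refine (stepMean_mono (fun _ _ _ => hA.integrable (hcn _)) ?_ fun m _ x hx => step m x hx).trans ?_
  · exact fun _ _ _ => hA.integrable (by fun_prop)
  -- MaxWeight is optimal for `q` and at best optimal for `p`, so the linear part has mean at most
  -- `-2 slack q + 2 slack p + 2 ε ‖ν‖ w`. Here `slack p ≤ 0`, and the `ε` term uses up half of `2 δ
  -- w`.
  have meanD : G.stepMean R α q (fun _ x a => D x a) ≤ K₀ - δ * w := by
    simp only [hD]
    rw [stepMean_add (fun _ _ _ => hA.integrable (by fun_prop))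
        (fun _ _ _ => hA.integrable (by fun_prop)),
      stepMean_sub (fun _ _ _ => hA.integrable (by fun_prop))
        (fun _ _ _ => hA.integrable (by fun_prop)), stepMean_const, stepMean_const_mul,
      stepMean_const_mul, stepMean_arrival (fun a => ⟪q - p, a⟫), hA.integral_inner he]
    have e1 : G.stepMean R α q (fun _ x _ => ⟪q - p, x⟫) =
        G.channelMean (G.maxRate q) - G.stepMean R α q (fun _ x _ => ⟪p, x⟫) := by
      rw [← stepMean_inner_self (R := R) (α := α),
        ← stepMean_sub (fun _ _ _ => hA.integrable (by fun_prop))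
        (fun _ _ _ => hA.integrable (by fun_prop))]
      simp only [inner_sub_left]
    have e2 := stepMean_inner_le (R := R) (α := α) (q := q) p
    have e3 := slack_nonpos_of_mem_collapseCone hp
    have e4 : -(w * ‖ν‖) ≤ ⟪q - p, ν⟫ := (abs_le.1 (abs_real_inner_le_norm (q - p) ν)).1
    have e5 : ε * -(w * ‖ν‖) ≤ ε * ⟪q - p, ν⟫ := mul_le_mul_of_nonneg_left e4 hε
    have e6 : w * (ε * ‖ν‖) ≤ w * (δ / 2) := mul_le_mul_of_nonneg_left hδ hw0
    have e7 : ⟪q - p, ν⟫ = ⟪q, ν⟫ - ⟪p, ν⟫ := inner_sub_left _ _ _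
    rw [inner_smul_right, e1]
    unfold slack at e3 hps
    linarith
  rw [stepMean_add (fun _ _ _ => hA.integrable (by fun_prop))
      (fun _ _ _ => hA.integrable (by fun_prop)),
    stepMean_add (fun _ _ _ => hA.integrable (by fun_prop))
      (fun _ _ _ => hA.integrable (by fun_prop)), stepMean_const, stepMean_const,
    stepMean_const_mul (φ := fun _ x a => D x a)]
  have := mul_le_mul_of_nonneg_left meanD (show 0 ≤ 2 * w ^ 2 by positivity)
  linarith

end Collapse

end GeneralizedSwitch

/-! ### Steady-state identities, state space collapse and the heavy traffic bound. -/

namespace GeneralizedSwitch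

variable {n : ℕ} {M : Type*} [Fintype M] {G : GeneralizedSwitch n M} {R : G.MaxWeight}
  {α π : ProbabilityMeasure (Vec n)} {A ε B : ℝ} {ν c : Vec n} {V : M → Vec n}

theorem ExposedVertex.nonneg (hV : G.ExposedVertex ν c V) (i : Fin n) : 0 ≤ ν i := by
  rw [← hV.sum_eq]
  simp only [WithLp.ofLp_sum, WithLp.ofLp_smul, Finset.sum_apply, Pi.smul_apply, smul_eq_mul]
  exact Finset.sum_nonneg fun m _ => mul_nonneg (G.ψ_mem.1 m) (G.S_nonneg m _ (hV.mem m) i)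

theorem abs_secondOrder_le (hA : BoundedArrivals α A) (hB : ∀ m, ∀ x ∈ G.S m, ‖x‖ ≤ B)
    {q : Vec n} (hq : ∀ i, 0 ≤ q i) :
    |G.secondOrder R α q| ≤ (n * |A| + B) ^ 2 + B ^ 2 := by
  have key : ∀ m, G.ψ m ≠ 0 → ∀ x ∈ G.S m, ∀ᵐ a ∂(α : Measure (Vec n)),
      |‖a - x‖ ^ 2 - ‖unusedService q a x‖ ^ 2| ≤ (n * |A| + B) ^ 2 + B ^ 2 := by
    intro m _ x hx
    filter_upwards [hA, hA.ae_norm_le] with a ha hna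
    have h1 : ‖a - x‖ ^ 2 ≤ (n * |A| + B) ^ 2 :=
      pow_le_pow_left₀ (norm_nonneg _) ((norm_sub_le a x).trans (by linarith [hB m x hx])) 2
    have h2 : ‖unusedService q a x‖ ^ 2 ≤ B ^ 2 :=
      pow_le_pow_left₀ (norm_nonneg _) ((norm_unusedService_le hq (fun i => (ha i).1)
        (G.S_nonneg m x hx)).trans (hB m x hx)) 2
    have h3 := sq_nonneg ‖a - x‖
    have h4 := sq_nonneg ‖unusedService q a x‖
    rw [abs_le]
    constructor <;> linarith
  rw [abs_le]
  constructor
  · rw [← stepMean_const (G := G) (R := R) (α := α) (q := q) (-_)]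
    refine stepMean_mono (fun _ _ _ => hA.integrable (by fun_prop))
      (fun _ _ _ => hA.integrable (by fun_prop)) fun m hm x hx => ?_
    filter_upwards [key m hm x hx] with a ha using (abs_le.1 ha).1
  · rw [← stepMean_const (G := G) (R := R) (α := α) (q := q) (_ + _)]
    refine stepMean_mono (fun _ _ _ => hA.integrable (by fun_prop))
      (fun _ _ _ => hA.integrable (by fun_prop)) fun m hm x hx => ?_
    filter_upwards [key m hm x hx] with a ha using (abs_le.1 ha).2

/-- The drift identity expresses it through a kernel integral and continuous functions. -/
theorem measurable_secondOrder (hA : BoundedArrivals α A) : Measurable (G.secondOrder R α) := by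
  have h : ∀ q, G.secondOrder R α q = ∫ y, ‖y‖ ^ 2 ∂G.queueKernel R α q -
      (‖q‖ ^ 2 + 2 * (⟪q, WithLp.toLp 2 fun i => ∫ a, a i ∂(α : Measure (Vec n))⟫ -
        G.channelMean (G.maxRate q))) := fun q => by
    rw [integral_norm_sq_queueKernel hA (e := WithLp.toLp 2 fun i =>
      ∫ a, a i ∂(α : Measure (Vec n))) fun i => rfl]
    ring
  rw [show G.secondOrder R α = _ from funext h]
  have h1 : Measurable fun q => ∫ y, ‖y‖ ^ 2 ∂G.queueKernel R α q :=
    measurable_integral_kernel (by fun_prop)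
  refine h1.sub (Continuous.measurable ?_)
  have := G.continuous_maxRate
  unfold channelMean
  fun_prop

theorem integrable_secondOrder (hA : BoundedArrivals α A) (hπ : G.IsSteadyState R α π) :
    Integrable (G.secondOrder R α) (π : Measure (Vec n)) := by
  obtain ⟨B, hB0, hB⟩ := G.exists_norm_service_le
  refine Integrable.of_bound (measurable_secondOrder hA).aestronglyMeasurable
    ((n * |A| + B) ^ 2 + B ^ 2) ?_
  filter_upwards [ae_nonneg_of_isSteadyState hπ] with q hq using abs_secondOrder_le hA hB hq

section SteadyState

variable (hV : G.ExposedVertex ν c V) (hA : BoundedArrivals α A)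
  (he : ∀ i, ∫ a, a i ∂(α : Measure (Vec n)) = ((1 - ε) • ν) i) (hπ : G.IsSteadyState R α π)

include hV hA he hπ

/-- Foster–Lyapunov with `‖q‖²`, whose drift is at most a constant minus `2 (ε ⟪q,ν⟫ + slack)`. -/
theorem ExposedVertex.integrable_inner_add_slack (hε : 0 < ε) :
    Integrable (fun q : Vec n => ⟪q, ν⟫) (π : Measure (Vec n)) ∧
      Integrable (G.slack ν) (π : Measure (Vec n)) := by
  obtain ⟨B, hB0, hB⟩ := G.exists_norm_service_le
  have hpos := ae_nonneg_of_isSteadyState hπ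
  have hin : ∀ᵐ q ∂(π : Measure (Vec n)), 0 ≤ ⟪q, ν⟫ := by
    filter_upwards [hpos] with q hq using inner_nonneg_of_nonneg hq hV.nonneg
  have mg : Measurable fun q : Vec n => 2 * (ε * ⟪q, ν⟫ + G.slack ν q) := by
    have := (G.continuous_slack ν).measurable
    fun_prop
  have ms := (G.continuous_slack ν).measurable
  have main := (integrable_and_integral_le_of_drift (κ := G.queueKernel R α)
    (f := fun q => ‖q‖ ^ 2) (b := (n * |A| + B) ^ 2 + B ^ 2) hπ (by positivity) (by fun_prop)
    (fun q => sq_nonneg _) mg (by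
      filter_upwards [hin] with q hq
      have := hV.slack_nonneg q
      positivity)
    (ae_of_all _ fun q => integrable_queueKernel (by fun_prop) fun m x hx =>
      hA.integrable (by fun_prop)) (by
      filter_upwards [hpos] with q hq
      rw [integral_norm_sq_queueKernel hA he, inner_smul_right, slack]
      have := (abs_le.1 (abs_secondOrder_le (R := R) hA hB hq)).2
      linarith)).1
  constructor
  · refine (main.const_mul (1 / ε)).mono' (by fun_prop) ?_
    filter_upwards [hin] with q hq
    have := hV.slack_nonneg q
    rw [Real.norm_of_nonneg hq, one_div, inv_mul_eq_div, le_div_iff₀ hε]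
    nlinarith
  · refine main.mono' ms.aestronglyMeasurable ?_
    filter_upwards [hin] with q hq
    have := hV.slack_nonneg q
    have := mul_nonneg hε.le hq
    rw [Real.norm_of_nonneg (hV.slack_nonneg q)]
    linarith

/-- The drift of the squared norm vanishes in steady state. -/
theorem ExposedVertex.integral_secondOrder (hε : 0 < ε) :
    2 * (ε * ∫ q, ⟪q, ν⟫ ∂(π : Measure (Vec n)) + ∫ q, G.slack ν q ∂(π : Measure (Vec n))) =
      ∫ q, G.secondOrder R α q ∂(π : Measure (Vec n)) := by
  obtain ⟨B, hB0, hB⟩ := G.exists_norm_service_le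
  obtain ⟨i1, i2⟩ := hV.integrable_inner_add_slack hA he hπ hε
  have hpos := ae_nonneg_of_isSteadyState hπ
  have hcsub : ∀ q : Vec n, Continuous fun y : Vec n => ‖y‖ ^ 2 - ‖q‖ ^ 2 := fun q => by fun_prop
  have isq : ∀ q : Vec n, Integrable (fun y => ‖y‖ ^ 2) (G.queueKernel R α q) := fun q =>
    integrable_queueKernel (by fun_prop) fun m x hx => hA.integrable (by fun_prop)
  -- Integrability of `‖q‖²` itself is not needed: its mean absolute increment is at most `E(2⟪q,a⟫
  -- + 2⟪q,s⟫)` plus a constant, which is this function.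
  have iD : Integrable (fun q => 2 * ((1 - ε) * ⟪q, ν⟫) + 2 * (G.slack ν q + ⟪q, ν⟫) +
      ((n * |A| + B) ^ 2 + B ^ 2)) (π : Measure (Vec n)) :=
    (((i1.const_mul _).const_mul _).add ((i2.add i1).const_mul _)).add (integrable_const _)
  have z := integral_drift_eq_zero (κ := G.queueKernel R α) (f := fun q => ‖q‖ ^ 2)
    hπ (by fun_prop) iD
    (ae_of_all _ fun q => (isq q).sub (integrable_const _)) (by
      filter_upwards [hpos] with q hq
      rw [integral_queueKernel (f := fun y => |‖y‖ ^ 2 - ‖q‖ ^ 2|) (hcsub q).abs.measurable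
        fun _ x _ => integrable_comp_nextQueue hA (hcsub q).abs _]
      have e1 : G.stepMean R α q (fun _ x a => 2 * ⟪q, a⟫ + 2 * ⟪q, x⟫ +
          ((n * |A| + B) ^ 2 + B ^ 2)) = 2 * ((1 - ε) * ⟪q, ν⟫) + 2 * (G.slack ν q + ⟪q, ν⟫) +
            ((n * |A| + B) ^ 2 + B ^ 2) := by
        rw [stepMean_add (fun _ _ _ => hA.integrable (by fun_prop))
            (fun _ _ _ => hA.integrable (by fun_prop)),
          stepMean_add (fun _ _ _ => hA.integrable (by fun_prop))
            (fun _ _ _ => hA.integrable (by fun_prop)), stepMean_const, stepMean_const_mul,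
          stepMean_const_mul, stepMean_arrival (fun a => ⟪q, a⟫), hA.integral_inner he,
          stepMean_inner_self, inner_smul_right, slack]
        ring
      rw [← e1]
      refine stepMean_mono (fun _ _ _ => hA.integrable (by fun_prop))
        (fun _ _ _ => hA.integrable (by fun_prop)) fun m _ x hx => ?_
      filter_upwards [hA, hA.ae_norm_le] with a ha hna
      have ha0 : ∀ i, 0 ≤ a i := fun i => (ha i).1
      have hx0 := G.S_nonneg m x hx
      have h1 : ‖a - x‖ ^ 2 ≤ (n * |A| + B) ^ 2 :=
        pow_le_pow_left₀ (norm_nonneg _) ((norm_sub_le a x).trans (by linarith [hB m x hx])) 2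
      have h2 : ‖unusedService q a x‖ ^ 2 ≤ B ^ 2 :=
        pow_le_pow_left₀ (norm_nonneg _) ((norm_unusedService_le hq ha0 hx0).trans (hB m x hx)) 2
      have h3 := sq_nonneg ‖a - x‖
      have h4 := sq_nonneg ‖unusedService q a x‖
      have h5 := inner_nonneg_of_nonneg hq ha0
      have h6 := inner_nonneg_of_nonneg hq hx0
      rw [norm_nextQueue_sq, add_sub_assoc, norm_add_sq_real, inner_sub_right, abs_le]
      constructor <;> linarith)
  have dr : ∀ q, ∫ y, (‖y‖ ^ 2 - ‖q‖ ^ 2) ∂G.queueKernel R α q =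
      G.secondOrder R α q - 2 * (ε * ⟪q, ν⟫ + G.slack ν q) := fun q => by
    rw [integral_sub (isq q) (integrable_const _), integral_norm_sq_queueKernel hA he,
      inner_smul_right, slack]
    simp
    ring
  simp only [dr] at z
  have i3 : Integrable (fun q => ε * ⟪q, ν⟫ + G.slack ν q) (π : Measure (Vec n)) :=
    (i1.const_mul _).add i2
  rw [integral_sub (integrable_secondOrder hA hπ) (i3.const_mul _), integral_const_mul,
    integral_add (i1.const_mul _) i2, integral_const_mul] at z
  linarith

/-- The drift of `⟪c, ·⟫` vanishes in steady state. -/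
theorem ExposedVertex.integral_loss :
    Integrable (G.loss R α c V) (π : Measure (Vec n)) ∧
      ∫ q, G.loss R α c V q ∂(π : Measure (Vec n)) = ε * ⟪c, ν⟫ := by
  obtain ⟨B, hB0, hB⟩ := G.exists_norm_service_le
  have hpos := ae_nonneg_of_isSteadyState hπ
  have isq : ∀ q : Vec n, Integrable (fun y => ⟪c, y⟫) (G.queueKernel R α q) := fun q =>
    integrable_queueKernel (by fun_prop) fun m x hx => hA.integrable (by fun_prop)
  have hcsub : ∀ q : Vec n, Continuous fun y : Vec n => ⟪c, y⟫ - ⟪c, q⟫ := fun q => by fun_prop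
  have bd : ∀ᵐ q ∂(π : Measure (Vec n)),
      ∫ y, |⟪c, y⟫ - ⟪c, q⟫| ∂G.queueKernel R α q ≤ ‖c‖ * (n * |A| + B + B) := by
    filter_upwards [hpos] with q hq
    rw [integral_queueKernel (f := fun y => |⟪c, y⟫ - ⟪c, q⟫|) (hcsub q).abs.measurable
        fun _ x _ => integrable_comp_nextQueue hA (hcsub q).abs _,
      ← stepMean_const (G := G) (R := R) (α := α) (q := q) (‖c‖ * _)]
    refine stepMean_mono (fun _ _ _ => hA.integrable (by fun_prop))
      (fun _ _ _ => hA.integrable (by fun_prop)) fun m _ x hx => ?_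
    filter_upwards [hA, hA.ae_norm_le] with a ha hna
    have e1 : ⟪c, nextQueue q a x⟫ - ⟪c, q⟫ = ⟪c, a - x + unusedService q a x⟫ := by
      rw [← inner_sub_right, nextQueue]
      congr 1
      abel
    rw [e1]
    refine (abs_real_inner_le_norm _ _).trans (mul_le_mul_of_nonneg_left ?_ (norm_nonneg _))
    have h1 := norm_add_le (a - x) (unusedService q a x)
    have h2 := norm_sub_le a x
    have h3 := norm_unusedService_le hq (fun i => (ha i).1) (G.S_nonneg m x hx)
    have h4 := hB m x hx
    linarith
  have z := integral_drift_eq_zero (κ := G.queueKernel R α) (f := fun q => ⟪c, q⟫)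
    hπ (by fun_prop) (integrable_const _)
    (ae_of_all _ fun q => (isq q).sub (integrable_const _)) bd
  have dr : ∀ q, ∫ y, (⟪c, y⟫ - ⟪c, q⟫) ∂G.queueKernel R α q =
      G.loss R α c V q - ε * ⟪c, ν⟫ := fun q => by
    rw [integral_sub (isq q) (integrable_const _), hV.integral_inner_queueKernel hA he,
      inner_smul_right]
    simp
    ring
  have ml : Measurable (G.loss R α c V) := by
    have h : ∀ q, G.loss R α c V q = ∫ y, ⟪c, y⟫ ∂G.queueKernel R α q -
        (⟪c, q⟫ + (⟪c, (1 - ε) • ν⟫ - ⟪c, ν⟫)) := fun q => by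
      rw [hV.integral_inner_queueKernel hA he]; ring
    rw [show G.loss R α c V = _ from funext h]
    have h1 : Measurable fun q => ∫ y, ⟪c, y⟫ ∂G.queueKernel R α q :=
      measurable_integral_kernel (by fun_prop)
    exact h1.sub (by fun_prop)
  have il : Integrable (fun q => G.loss R α c V q - ε * ⟪c, ν⟫) (π : Measure (Vec n)) := by
    refine Integrable.of_bound (ml.sub_const _).aestronglyMeasurable (‖c‖ * (n * |A| + B + B)) ?_
    filter_upwards [bd] with q hq
    rw [← dr]
    exact (norm_integral_le_integral_norm _).trans hq
  have il' : Integrable (G.loss R α c V) (π : Measure (Vec n)) := by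
    refine (il.add (integrable_const (ε * ⟪c, ν⟫))).congr (ae_of_all _ fun q => ?_)
    simp
  refine ⟨il', ?_⟩
  simp only [dr] at z
  rw [integral_sub il' (integrable_const _)] at z
  simp at z
  linarith

end SteadyState

/-- The negative cubic term wins once `w ≥ k / (2δ)`, where `k` collects all quadratic coefficients
and `1` for the `-w ^ 2` on the right. -/
theorem exists_cubic_bound {δ : ℝ} (hδ : 0 < δ) (K₀ K₁ : ℝ) :
    ∃ b, 0 ≤ b ∧ ∀ w, 0 ≤ w →
      2 * w ^ 2 * (K₀ - δ * w) + (K₁ * w + K₀) ^ 2 ≤ -w ^ 2 + b := by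
  set k := 2 * |K₀| + 2 * K₁ ^ 2 + 1 with hk
  have hk0 : 0 ≤ k := by positivity
  refine ⟨2 * K₀ ^ 2 + k * (k / (2 * δ)) ^ 2, by positivity, fun w hw => ?_⟩
  have h1 : (K₁ * w + K₀) ^ 2 ≤ 2 * K₁ ^ 2 * w ^ 2 + 2 * K₀ ^ 2 := by
    nlinarith [sq_nonneg (K₁ * w - K₀)]
  have h2 : K₀ * w ^ 2 ≤ |K₀| * w ^ 2 := mul_le_mul_of_nonneg_right (le_abs_self _) (sq_nonneg _)
  have h3 : k * w ^ 2 - 2 * δ * w ^ 3 ≤ k * (k / (2 * δ)) ^ 2 := by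
    rcases le_total w (k / (2 * δ)) with h | h
    · have : k * w ^ 2 ≤ k * (k / (2 * δ)) ^ 2 := by gcongr
      have : 0 ≤ 2 * δ * w ^ 3 := by positivity
      linarith
    · have h4 : k ≤ w * (2 * δ) := (div_le_iff₀ (by positivity)).1 h
      have h5 : k * w ^ 2 ≤ w * (2 * δ) * w ^ 2 := by gcongr
      have : 0 ≤ k * (k / (2 * δ)) ^ 2 := by positivity
      linarith
  rw [hk] at h3 ⊢
  linarith

/-- State space collapse: close to the boundary of the capacity region, the second moment of the
distance to the collapse cone is uniformly bounded. -/
theorem ExposedVertex.exists_second_moment_bound (hV : G.ExposedVertex ν c V) (A : ℝ) :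
    ∃ b : ℝ, ∃ ε₀ > (0 : ℝ), ∀ ε, 0 < ε → ε < ε₀ → ∀ (R : G.MaxWeight) (α π : ProbabilityMeasure (Vec n)),
      BoundedArrivals α A → (∀ i, ∫ a, a i ∂(α : Measure (Vec n)) = ((1 - ε) • ν) i) →
      G.IsSteadyState R α π →
      Integrable (fun q => Metric.infDist q (G.collapseCone ν) ^ 2) (π : Measure (Vec n)) ∧
      ∫ q, Metric.infDist q (G.collapseCone ν) ^ 2 ∂(π : Measure (Vec n)) ≤ b := by
  obtain ⟨B, hB0, hB⟩ := G.exists_norm_service_le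
  obtain ⟨δ, hδ, hdist⟩ := hV.exists_error_bound
  obtain ⟨b, hb, hcub⟩ := exists_cubic_bound hδ (2 * B ^ 2 + (n * |A| + 2 * B) ^ 2)
    (2 * (n * |A| + B))
  -- The threshold ensures `ε ‖ν‖ ≤ δ / 2`; the `+ 1` covers `ν = 0`.
  refine ⟨b, δ / 2 / (‖ν‖ + 1), by positivity, fun ε hε hε' R α π hA he hπ => ?_⟩
  have hεν : ε * ‖ν‖ ≤ δ / 2 := by
    rw [lt_div_iff₀ (by positivity)] at hε'
    linarith
  have hc := Metric.continuous_infDist_pt (G.collapseCone ν)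
  refine integrable_and_integral_le_of_drift (κ := G.queueKernel R α)
    (f := fun q => Metric.infDist q (G.collapseCone ν) ^ 4) hπ hb (hc.pow 4).measurable
    (fun q => pow_nonneg Metric.infDist_nonneg 4) (hc.pow 2).measurable
    (ae_of_all _ fun q => sq_nonneg _)
    (ae_of_all _ fun q => integrable_queueKernel (hc.pow 4).measurable fun m x hx =>
      integrable_comp_nextQueue hA (hc.pow 4) x) ?_
  filter_upwards [ae_nonneg_of_isSteadyState hπ] with q hq
  obtain ⟨p, hp, hpd, hps⟩ := hdist q hq
  have h1 := integral_infDist_pow_four_le (R := R) hA he hB hε.le hεν le_rfl hp hps hq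
  have h2 := hcub ‖q - p‖ (norm_nonneg _)
  rw [hpd]
  linarith

/-- The heavy traffic limit of the switch at an exposed vertex, with the rate of convergence. -/
theorem ExposedVertex.exists_heavyTraffic_bound (hV : G.ExposedVertex ν c V) (A : ℝ) :
    ∃ K : ℝ, ∃ ε₀ > (0 : ℝ), ∀ ε, 0 < ε → ε < ε₀ → ∀ (R : G.MaxWeight) (α π : ProbabilityMeasure (Vec n)),
      BoundedArrivals α A → (∀ i, ∫ a, a i ∂(α : Measure (Vec n)) = ((1 - ε) • ν) i) →
      G.IsSteadyState R α π →
      |2 * (ε * ∫ q, ⟪q, ν⟫ ∂(π : Measure (Vec n))) - (∑ i, arrivalCov α i i +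
        G.channelMean fun m => ‖V m - (1 - ε) • ν‖ ^ 2)| ≤ K * √ε := by
  obtain ⟨B, hB0, hB⟩ := G.exists_norm_service_le
  obtain ⟨b, ε₁, hε₁, hmom⟩ := hV.exists_second_moment_bound A
  obtain ⟨δ, hδ, hdist⟩ := hV.exists_error_bound
  obtain ⟨γ, hγ, hγc⟩ := hV.exists_pos_le
  obtain ⟨η, hη, hgap⟩ := hV.exists_gap
  set K₁ := (B + ‖ν‖) ^ 2 / η + B / γ with hK₁
  have hK₁0 : 0 ≤ K₁ := by positivity
  have hcν : 0 ≤ ⟪c, ν⟫ := inner_nonneg_of_nonneg (fun i => (hV.pos i).le) hV.nonneg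
  refine ⟨K₁ * ⟪c, ν⟫ + 2 * ((B + ‖ν‖) * (b + ⟪c, ν⟫ / η)), min ε₁ 1, by positivity,
    fun ε hε hε' R α π hA he hπ => ?_⟩
  have hε1 : ε < 1 := hε'.trans_le (min_le_right _ _)
  obtain ⟨iW, hW⟩ := hmom ε hε (hε'.trans_le (min_le_left _ _)) R α π hA he hπ
  obtain ⟨-, iT⟩ := hV.integrable_inner_add_slack hA he hπ hε
  obtain ⟨iL, hL⟩ := hV.integral_loss hA he hπ
  have iS := integrable_secondOrder hA hπ
  have hS := hV.integral_secondOrder hA he hπ hε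
  have hpos := ae_nonneg_of_isSteadyState hπ
  have hs : 0 < √ε := Real.sqrt_pos.2 hε
  have hss : √ε * √ε = ε := Real.mul_self_sqrt hε.le
  have heν : ‖(1 - ε) • ν‖ ≤ ‖ν‖ := by
    rw [norm_smul, Real.norm_of_nonneg (by linarith)]
    exact mul_le_of_le_one_left (norm_nonneg _) (by linarith)
  set k := ∑ i, arrivalCov α i i + G.channelMean fun m => ‖V m - (1 - ε) • ν‖ ^ 2 with hk
  have b1 : |∫ q, G.secondOrder R α q ∂(π : Measure (Vec n)) - k| ≤ K₁ * (ε * ⟪c, ν⟫) := by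
    have e1 : ∫ q, G.secondOrder R α q ∂(π : Measure (Vec n)) - k =
        ∫ q, (G.secondOrder R α q - k) ∂(π : Measure (Vec n)) := by
      rw [integral_sub iS (integrable_const _)]; simp
    rw [e1, ← hL, ← integral_const_mul]
    refine (norm_integral_le_integral_norm _).trans
      (integral_mono_ae (iS.sub (integrable_const _)).norm (iL.const_mul _) ?_)
    filter_upwards [hpos] with q hq
    exact hV.abs_secondOrder_sub_le hA he hγ hγc hη hgap hB heν hq
  -- With `d` the distance to the cone, `d ≤ √ε d² + 1/√ε`. Where the slack is positive the loss is
  -- at least `η`, so `1/√ε ≤ loss / (η √ε)`; as `E loss = ε ⟪c,ν⟫`, both terms have mean `O(√ε)`.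
  have b2 : ∫ q, G.slack ν q ∂(π : Measure (Vec n)) ≤
      (B + ‖ν‖) * (b + ⟪c, ν⟫ / η) * √ε := by
    have pt : ∀ᵐ q ∂(π : Measure (Vec n)), G.slack ν q ≤ (B + ‖ν‖) *
        (√ε * Metric.infDist q (G.collapseCone ν) ^ 2 + 1 / (η * √ε) * G.loss R α c V q) := by
      filter_upwards [hpos] with q hq
      obtain ⟨p, hp, hpd, -⟩ := hdist q hq
      have hl := hV.loss_nonneg (R := R) (q := q) hA
      rcases (hV.slack_nonneg q).eq_or_lt with h0 | h0
      · rw [← h0]; positivity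
      · refine (slack_le_mul_norm hB hp q).trans ?_
        rw [hpd]
        refine mul_le_mul_of_nonneg_left ?_ (by positivity)
        have h1 := hV.le_loss_of_slack_pos (R := R) hA hgap h0
        have h2 : 1 / √ε ≤ 1 / (η * √ε) * G.loss R α c V q := by
          rw [div_mul_eq_mul_div, one_mul, div_le_div_iff₀ hs (by positivity)]
          nlinarith
        have h3 : ‖q - p‖ ≤ √ε * ‖q - p‖ ^ 2 + 1 / √ε := by
          rw [← sub_nonneg]
          have : √ε * ‖q - p‖ ^ 2 + 1 / √ε - ‖q - p‖ =
              ((√ε * ‖q - p‖ - 1) ^ 2 + √ε * ‖q - p‖) / √ε := by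
            field_simp; ring
          rw [this]
          positivity
        linarith
    have i1 := iW.const_mul √ε
    have i2 := iL.const_mul (1 / (η * √ε))
    have i3 : Integrable (fun q => √ε * Metric.infDist q (G.collapseCone ν) ^ 2 +
        1 / (η * √ε) * G.loss R α c V q) (π : Measure (Vec n)) := i1.add i2
    refine (integral_mono_ae iT (i3.const_mul _) pt).trans ?_
    rw [integral_const_mul, integral_add i1 i2, integral_const_mul, integral_const_mul, hL,
      mul_assoc]
    refine mul_le_mul_of_nonneg_left ?_ (by positivity)
    have e2 : 1 / (η * √ε) * (ε * ⟪c, ν⟫) = ⟪c, ν⟫ / η * √ε := by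
      nth_rewrite 2 [← hss]
      field_simp
    rw [e2, add_mul, mul_comm b]
    gcongr
  have b3 : 0 ≤ ∫ q, G.slack ν q ∂(π : Measure (Vec n)) := integral_nonneg hV.slack_nonneg
  have b4 : K₁ * (ε * ⟪c, ν⟫) ≤ K₁ * ⟪c, ν⟫ * √ε := by
    have h1 : ε ≤ √ε := by
      nlinarith [Real.sqrt_le_one.2 hε1.le]
    have := mul_le_mul_of_nonneg_left h1 (mul_nonneg hK₁0 hcν)
    linarith
  have b5 := abs_le.1 b1
  have b6 : 2 * (ε * ∫ q, ⟪q, ν⟫ ∂(π : Measure (Vec n))) - k =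
      (∫ q, G.secondOrder R α q ∂(π : Measure (Vec n)) - k) -
        2 * ∫ q, G.slack ν q ∂(π : Measure (Vec n)) := by linarith
  have b7 : 0 ≤ (B + ‖ν‖) * (b + ⟪c, ν⟫ / η) * √ε := b3.trans b2
  rw [b6, abs_le]
  constructor <;> linarith

end GeneralizedSwitch

/-! ### From facet normals to an exposed vertex; the Gram matrix formula. -/

theorem eq_of_forall_inner_eq_of_span_eq_top {E ι : Type*} [NormedAddCommGroup E]
    [InnerProductSpace ℝ E] {v : ι → E} {s : Set ι} (hs : Submodule.span ℝ (v '' s) = ⊤) {x y : E}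
    (h : ∀ i ∈ s, ⟪v i, x⟫ = ⟪v i, y⟫) : x = y := by
  have h1 : Submodule.span ℝ (v '' s) ≤ (ℝ ∙ (x - y))ᗮ := by
    rw [Submodule.span_le]
    rintro _ ⟨i, hi, rfl⟩
    rw [SetLike.mem_coe, Submodule.mem_orthogonal_singleton_iff_inner_left, inner_sub_right, h i hi,
      sub_self]
  have h2 : x - y ∈ (ℝ ∙ (x - y))ᗮ := h1 (hs ▸ Submodule.mem_top)
  rw [Submodule.mem_orthogonal_singleton_iff_inner_left, inner_self_eq_zero] at h2
  exact sub_eq_zero.1 h2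

open Matrix in
/-- The inverse Gram matrix computes the norm of a vector from its inner products with a basis. -/
theorem dotProduct_inv_gram_mulVec {E ι : Type*} [NormedAddCommGroup E] [InnerProductSpace ℝ E]
    [Fintype ι] [DecidableEq ι] {v : ι → E} (hv : LinearIndependent ℝ v)
    (hs : Submodule.span ℝ (Set.range v) = ⊤) (z : E) :
    (fun i => ⟪v i, z⟫) ⬝ᵥ ((gram ℝ v)⁻¹ *ᵥ fun i => ⟪v i, z⟫) = ‖z‖ ^ 2 := by
  obtain ⟨ξ, rfl⟩ := (Submodule.mem_span_range_iff_exists_fun ℝ).1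
    (hs ▸ Submodule.mem_top : z ∈ Submodule.span ℝ (Set.range v))
  have h1 : (fun i => ⟪v i, ∑ j, ξ j • v j⟫) = gram ℝ v *ᵥ ξ := by
    funext i
    simp only [mulVec, dotProduct, gram_apply, inner_sum, inner_smul_right]
    exact Finset.sum_congr rfl fun j _ => mul_comm _ _
  have hu : IsUnit (gram ℝ v).det :=
    (det_gram_ne_zero_iff_linearIndependent.2 hv).isUnit
  rw [h1, mulVec_mulVec, nonsing_inv_mul _ hu, one_mulVec, ← h1, ← real_inner_self_eq_norm_sq,
    sum_inner]
  simp only [dotProduct, real_inner_smul_left]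
  exact Finset.sum_congr rfl fun j _ => mul_comm _ _

namespace GeneralizedSwitch

variable {n L : ℕ} {M : Type*} [Fintype M] {G : GeneralizedSwitch n M}

theorem inner_le_maxRate_of_mem_convexHull {c y : Vec n} {m : M}
    (hy : y ∈ convexHull ℝ (G.S m : Set (Vec n))) : ⟪c, y⟫ ≤ G.maxRate c m := by
  have hc : Convex ℝ {y : Vec n | ⟪c, y⟫ ≤ G.maxRate c m} :=
    convex_halfSpace_le (innerₛₗ ℝ c).isLinear _
  exact convexHull_min (fun x hx => inner_le_maxRate hx) hc hy

variable {D : FacetDescription G.capacityRegion L} {ν : Vec n}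

theorem mem_facet_of_mem_active {ℓ : Fin L} (h : ℓ ∈ D.active ν) : ν ∈ D.facet ℓ := by
  simpa [FacetDescription.active] using h

/-- The support function of the weighted sum of hulls is the weighted sum of the support functions,
and on an active facet `ν` attains it. -/
theorem channelMean_maxRate_of_mem_active {ℓ : Fin L} (h : ℓ ∈ D.active ν) :
    G.channelMean (G.maxRate (D.c ℓ)) = ⟪D.c ℓ, ν⟫ := by
  obtain ⟨hν, hb⟩ := mem_facet_of_mem_active h
  obtain ⟨y, hy, hsum⟩ := hν
  refine le_antisymm ?_ ?_
  · choose x hx hmax using G.exists_inner_eq_maxRate (D.c ℓ)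
    have hmem : ∑ m, G.ψ m • x m ∈ G.capacityRegion :=
      ⟨x, fun m => subset_convexHull ℝ _ (hx m), rfl⟩
    have hcut := D.cutOut
    rw [IsCutOutBy] at hcut
    rw [hcut] at hmem
    have := hmem.2 ℓ
    rw [hb]
    simp only [inner_sum, inner_smul_right, hmax] at this
    exact this
  · rw [hsum, inner_sum]
    simp only [inner_smul_right]
    exact G.channelMean_mono fun m => inner_le_maxRate_of_mem_convexHull (hy m)

theorem span_active_eq_top (hK : Module.finrank ℝ (Submodule.span ℝ (D.cone ν)) = n) :
    Submodule.span ℝ (D.c '' (D.active ν : Set (Fin L))) = ⊤ := by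
  rw [eq_top_iff, ← Submodule.eq_top_of_finrank_eq (S := Submodule.span ℝ (D.cone ν))
    (by rw [hK, finrank_euclideanSpace_fin]), Submodule.span_le]
  rintro _ ⟨-, ξ, -, rfl⟩
  exact Submodule.sum_mem _ fun ℓ hℓ => Submodule.smul_mem _ _
    (Submodule.subset_span ⟨ℓ, hℓ, rfl⟩)

/-- In a channel state of positive probability, a schedule that maximizes the rate in the direction of
the sum of the active normals maximizes the rate in the direction of each active normal. -/
theorem inner_eq_maxRate_of_sum_active_maximizer (D : FacetDescription G.capacityRegion L) (ν : Vec n) (m : M)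
    (hm : G.ψ m ≠ 0) {x : Vec n} (hx : x ∈ G.S m)
    (hmax : G.maxRate (∑ ℓ ∈ D.active ν, D.c ℓ) m ≤ ⟪∑ ℓ ∈ D.active ν, D.c ℓ, x⟫) :
    ∀ ℓ ∈ D.active ν, ⟪D.c ℓ, x⟫ = G.maxRate (D.c ℓ) m := by
  intro ℓ₀ hℓ₀
  obtain ⟨y, hy, hsum⟩ := (mem_facet_of_mem_active hℓ₀).1
  -- Equality of the means forces equality in each state of positive weight, so one point `y m` of
  -- the hull maximizes all active normals at once. A maximizer of their sum must then match it term
  -- by term.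
  have hyeq : ∀ ℓ ∈ D.active ν, ⟪D.c ℓ, y m⟫ = G.maxRate (D.c ℓ) m := by
    intro ℓ hℓ
    have h1 := channelMean_maxRate_of_mem_active hℓ
    rw [hsum, inner_sum] at h1
    simp only [inner_smul_right, channelMean] at h1
    have h2 := (Finset.sum_eq_sum_iff_of_le fun m _ => mul_le_mul_of_nonneg_left
      (inner_le_maxRate_of_mem_convexHull (c := D.c ℓ) (hy m)) (G.ψ_mem.1 m)).1 h1.symm m
        (Finset.mem_univ m)
    exact mul_left_cancel₀ hm h2
  have h3 : ∑ ℓ ∈ D.active ν, G.maxRate (D.c ℓ) m ≤ ∑ ℓ ∈ D.active ν, ⟪D.c ℓ, x⟫ := by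
    rw [← sum_inner, ← Finset.sum_congr rfl hyeq, ← sum_inner]
    exact (inner_le_maxRate_of_mem_convexHull (hy m)).trans hmax
  have h4 : ∀ ℓ ∈ D.active ν, ⟪D.c ℓ, x⟫ ≤ G.maxRate (D.c ℓ) m := fun ℓ _ => inner_le_maxRate hx
  exact (Finset.sum_eq_sum_iff_of_le h4).1 (le_antisymm (Finset.sum_le_sum h4) h3) ℓ₀ hℓ₀

/-- Inner products with the spanning active normals determine a vector. Those of a maximizer of `c`
are the maximal rates, so it is unique, and those of the mean of `V` agree with those of `ν`. A zero
coordinate of `c` would make a basis vector orthogonal to every active normal. -/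
theorem exists_exposedVertex (D : FacetDescription G.capacityRegion L) (ν : Vec n)
    (hK : Module.finrank ℝ (Submodule.span ℝ (D.cone ν)) = n) :
    ∃ c V, G.ExposedVertex ν c V ∧
      ∀ ℓ ∈ D.active ν, ∀ m, G.ψ m ≠ 0 → ⟪D.c ℓ, V m⟫ = G.maxRate (D.c ℓ) m := by
  have hspan := span_active_eq_top hK
  set c : Vec n := ∑ ℓ ∈ D.active ν, D.c ℓ with hc
  choose V hV hVmax using G.exists_inner_eq_maxRate c
  have hVeq : ∀ ℓ ∈ D.active ν, ∀ m, G.ψ m ≠ 0 → ⟪D.c ℓ, V m⟫ = G.maxRate (D.c ℓ) m :=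
    fun ℓ hℓ m hm => inner_eq_maxRate_of_sum_active_maximizer D ν m hm (hV m) (hVmax m).ge ℓ hℓ
  refine ⟨c, V, ⟨hV, ?_, ?_, ?_⟩, hVeq⟩
  · refine eq_of_forall_inner_eq_of_span_eq_top hspan fun ℓ hℓ => ?_
    rw [← channelMean_maxRate_of_mem_active hℓ, inner_sum, channelMean]
    refine Finset.sum_congr rfl fun m _ => ?_
    by_cases hm : G.ψ m = 0
    · simp [hm]
    · rw [inner_smul_right, hVeq ℓ hℓ m hm]
  · intro i
    have hci : c i = ∑ ℓ ∈ D.active ν, D.c ℓ i := by simp [hc]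
    rw [hci]
    refine (Finset.sum_nonneg fun ℓ _ => D.c_nonneg ℓ i).lt_of_ne fun h0 => ?_
    have h1 := (Finset.sum_eq_zero_iff_of_nonneg fun ℓ _ => D.c_nonneg ℓ i).1 h0.symm
    have h2 : EuclideanSpace.single i (1 : ℝ) = 0 :=
      eq_of_forall_inner_eq_of_span_eq_top hspan fun ℓ hℓ => by
        simpa [EuclideanSpace.inner_single_right] using h1 ℓ hℓ
    simpa using congrArg (fun x : Vec n => x i) h2
  · intro m hm x hx hne
    by_contra! hle
    refine hne (eq_of_forall_inner_eq_of_span_eq_top hspan fun ℓ hℓ => ?_)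
    rw [inner_eq_maxRate_of_sum_active_maximizer D ν m hm hx ((hVmax m).ge.trans hle) ℓ hℓ, hVeq ℓ hℓ m hm]

theorem covB_apply (G : GeneralizedSwitch n M) (D : FacetDescription G.capacityRegion L)
    (ℓ₁ ℓ₂ : Fin L) : G.covB D ℓ₁ ℓ₂ = ∑ m, G.ψ m *
      ((G.maxRate (D.c ℓ₁) m - G.channelMean (G.maxRate (D.c ℓ₁))) *
        (G.maxRate (D.c ℓ₂) m - G.channelMean (G.maxRate (D.c ℓ₂)))) := by
  have h1 := G.ψ_mem.2
  set k₁ := G.channelMean (G.maxRate (D.c ℓ₁)) with hk₁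
  set k₂ := G.channelMean (G.maxRate (D.c ℓ₂)) with hk₂
  have h2 : ∀ m, G.ψ m * ((G.maxRate (D.c ℓ₁) m - k₁) * (G.maxRate (D.c ℓ₂) m - k₂)) =
      G.ψ m * (G.maxRate (D.c ℓ₁) m * G.maxRate (D.c ℓ₂) m) -
        G.ψ m * G.maxRate (D.c ℓ₁) m * k₂ - G.ψ m * G.maxRate (D.c ℓ₂) m * k₁ +
          G.ψ m * (k₁ * k₂) := fun m => by ring
  simp only [h2, Finset.sum_add_distrib, Finset.sum_sub_distrib, ← Finset.sum_mul, h1]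
  rw [show ∑ m, G.ψ m * G.maxRate (D.c ℓ₁) m = k₁ from rfl,
    show ∑ m, G.ψ m * G.maxRate (D.c ℓ₂) m = k₂ from rfl]
  simp only [covB, Matrix.of_apply, channelMean] at *
  rw [← hk₁, ← hk₂]
  ring

open Matrix in
theorem sum_inv_colMatrix_hadamard_covB {V : M → Vec n}
    (hV : ∀ ℓ ∈ D.active ν, ∀ m, G.ψ m ≠ 0 → ⟪D.c ℓ, V m⟫ = G.maxRate (D.c ℓ) m)
    (hspan : Submodule.span ℝ (D.c '' (D.active ν : Set (Fin L))) = ⊤)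
    {Pt : Finset (Fin L)} (hPt : D.IsBasisIndex ν Pt) :
    (1 : Pt → ℝ) ⬝ᵥ ((((D.colMatrix Pt)ᵀ * D.colMatrix Pt)⁻¹ ⊙
      (G.covB D).submatrix (fun ℓ : Pt => (ℓ : Fin L)) (fun ℓ : Pt => (ℓ : Fin L))) *ᵥ
        (1 : Pt → ℝ)) = G.channelMean fun m => ‖V m - ν‖ ^ 2 := by
  obtain ⟨hsub, hli, hsp⟩ := hPt
  have hrange : Submodule.span ℝ (Set.range fun ℓ : Pt => D.c ℓ) = ⊤ := by
    rw [← hspan, ← hsp, Set.image_eq_range]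
    rfl
  have hgram : (D.colMatrix Pt)ᵀ * D.colMatrix Pt = gram ℝ fun ℓ : Pt => D.c ℓ := by
    ext i j
    simp [mul_apply, FacetDescription.colMatrix, gram_apply, inner_eq_sum_mul]
  have hz : ∀ m, G.ψ m * ‖V m - ν‖ ^ 2 = G.ψ m * ∑ i : Pt, ∑ j : Pt,
      (gram ℝ fun ℓ : Pt => D.c ℓ)⁻¹ i j *
      ((G.maxRate (D.c i) m - G.channelMean (G.maxRate (D.c i))) *
        (G.maxRate (D.c j) m - G.channelMean (G.maxRate (D.c j)))) := by
    intro m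
    by_cases hm : G.ψ m = 0
    · simp [hm]
    congr 1
    have h1 : ∀ ℓ : Pt, ⟪D.c ℓ, V m - ν⟫ =
        G.maxRate (D.c ℓ) m - G.channelMean (G.maxRate (D.c ℓ)) := fun ℓ => by
      rw [inner_sub_right, hV ℓ (hsub ℓ.2) m hm, channelMean_maxRate_of_mem_active (hsub ℓ.2)]
    rw [← dotProduct_inv_gram_mulVec hli hrange]
    simp only [dotProduct, mulVec, h1, Finset.mul_sum]
    exact Finset.sum_congr rfl fun i _ => Finset.sum_congr rfl fun j _ => by ring
  rw [channelMean, Finset.sum_congr rfl fun m _ => hz m, hgram]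
  simp only [dotProduct, mulVec, hadamard_apply, submatrix_apply, Pi.one_apply, one_mul, mul_one,
    covB_apply, Finset.mul_sum]
  symm
  rw [Finset.sum_comm]
  refine Finset.sum_congr rfl fun i _ => ?_
  rw [Finset.sum_comm]
  exact Finset.sum_congr rfl fun j _ => Finset.sum_congr rfl fun m _ => by ring

end GeneralizedSwitch

/-! ### The heavy traffic limit. -/

theorem corollary3 {n L : ℕ} {M : Type*} [Fintype M] (G : GeneralizedSwitch n M)
    (D : FacetDescription G.capacityRegion L)
    (ν : Vec n) (hν : ν ∈ frontier G.capacityRegion)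
    (hK : Module.finrank ℝ (Submodule.span ℝ (D.cone ν)) = n)
    (Pt : Finset (Fin L)) (hPt : D.IsBasisIndex ν Pt)
    (w : Vec n) (hw : ∀ ℓ ∈ D.active ν, w ∈ D.facet ℓ)
    (Amax : ℝ) (R : ℝ → G.MaxWeight) (α π : ℝ → ProbabilityMeasure (Vec n))
    (hα : ∀ ε ∈ Set.Ioo (0 : ℝ) 1, BoundedArrivals (α ε) Amax)
    (hmean : ∀ ε ∈ Set.Ioo (0 : ℝ) 1, ∀ i,
      ∫ a, a i ∂(α ε : Measure (Vec n)) = (1 - ε) * ν i)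
    (hπ : ∀ ε ∈ Set.Ioo (0 : ℝ) 1, G.IsSteadyState (R ε) (α ε) (π ε))
    (covA : Matrix (Fin n) (Fin n) ℝ)
    (hcovA : ∀ i j, Tendsto (fun ε => arrivalCov (α ε) i j) (𝓝[>] 0) (𝓝 (covA i j)))
    (σa : Vec n) (hσa : ∀ i, σa i = Real.sqrt (covA i i)) :
    (∀ ε ∈ Set.Ioo (0 : ℝ) 1, Integrable (fun q : Vec n => ⟪q, w⟫) (π ε : Measure (Vec n))) ∧
    Tendsto (fun ε => ε * ∫ q, ⟪q, w⟫ ∂(π ε : Measure (Vec n))) (𝓝[>] 0)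
      (𝓝 (1 / 2 * (‖σa‖ ^ 2 +
        (1 : Pt → ℝ) ⬝ᵥ ((((D.colMatrix Pt)ᵀ * D.colMatrix Pt)⁻¹ ⊙
          (G.covB D).submatrix (fun ℓ : Pt => (ℓ : Fin L)) (fun ℓ : Pt => (ℓ : Fin L))) *ᵥ
            (1 : Pt → ℝ))))) := by
  obtain ⟨c, V, hEV, hVmax⟩ := GeneralizedSwitch.exists_exposedVertex D ν hK
  have hspan := GeneralizedSwitch.span_active_eq_top hK
  -- The active normals span, so the active facets meet only in `ν`.
  obtain rfl : w = ν := eq_of_forall_inner_eq_of_span_eq_top hspan fun ℓ hℓ =>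
    (hw ℓ hℓ).2.trans (GeneralizedSwitch.mem_facet_of_mem_active (ν := ν) hℓ).2.symm
  have hmean' : ∀ ε ∈ Set.Ioo (0 : ℝ) 1, ∀ i,
      ∫ a, a i ∂(α ε : Measure (Vec n)) = ((1 - ε) • w) i := fun ε hε i => by
    rw [hmean ε hε i]; rfl
  refine ⟨fun ε hε =>
    (hEV.integrable_inner_add_slack (hα ε hε) (hmean' ε hε) (hπ ε hε) hε.1).1, ?_⟩
  rw [GeneralizedSwitch.sum_inv_colMatrix_hadamard_covB hVmax hspan hPt]
  obtain ⟨K, ε₀, hε₀, hbound⟩ := hEV.exists_heavyTraffic_bound Amax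
  have hunit : ∀ᶠ ε in 𝓝[>] (0 : ℝ), ε ∈ Set.Ioo (0 : ℝ) 1 := Ioo_mem_nhdsGT one_pos
  have hcov0 : ∀ i, 0 ≤ covA i i := fun i => by
    refine ge_of_tendsto (hcovA i i) (Eventually.of_forall fun ε => ?_)
    simp only [arrivalCov, Matrix.of_apply, covariance]
    exact integral_nonneg fun a => mul_self_nonneg _
  have hσ : ‖σa‖ ^ 2 = ∑ i, covA i i := by
    rw [norm_sq_eq_sum]
    exact Finset.sum_congr rfl fun i _ => by rw [hσa, Real.sq_sqrt (hcov0 i)]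
  have hlim : Tendsto (fun ε : ℝ => ∑ i, arrivalCov (α ε) i i +
      G.channelMean fun m => ‖V m - (1 - ε) • w‖ ^ 2) (𝓝[>] 0)
      (𝓝 (‖σa‖ ^ 2 + G.channelMean fun m => ‖V m - w‖ ^ 2)) := by
    rw [hσ]
    refine (tendsto_finsetSum _ fun i _ => hcovA i i).add ?_
    have hcont : Continuous fun ε : ℝ => G.channelMean fun m => ‖V m - (1 - ε) • w‖ ^ 2 := by
      unfold GeneralizedSwitch.channelMean
      fun_prop
    simpa using (hcont.tendsto 0).mono_left nhdsWithin_le_nhds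
  have herr : Tendsto (fun ε => 2 * (ε * ∫ q, ⟪q, w⟫ ∂(π ε : Measure (Vec n))) -
      (∑ i, arrivalCov (α ε) i i + G.channelMean fun m => ‖V m - (1 - ε) • w‖ ^ 2))
      (𝓝[>] 0) (𝓝 0) := by
    refine squeeze_zero_norm' (a := fun ε => K * √ε) ?_ ?_
    · filter_upwards [hunit, Ioo_mem_nhdsGT hε₀] with ε hε hε'
      exact hbound ε hε.1 hε'.2 (R ε) (α ε) (π ε) (hα ε hε) (hmean' ε hε) (hπ ε hε)
    · have hcont : Continuous fun ε : ℝ => K * √ε := by fun_prop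
      simpa using (hcont.tendsto 0).mono_left nhdsWithin_le_nhds
  have := (herr.add hlim).const_mul (1 / 2)
  rw [zero_add] at this
  refine this.congr fun ε => ?_
  ring
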